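/- Let $f\in \mathrm{SL}_2(\mathbb{Z})$ be hyperbolic (i.e. $|\operatorname{tr} f|>2$), let $T^2=\mathbb{R}^2/\mathbb{Z}^2$, and let $M$ be the Sol $3$-manifold obtained from $\mathbb{R}\times T^2$ by the identification $(s,w)\sim(s+1,f(w))$, oriented by the standard orientation of $\mathbb{R}\times\mathbb{R}^2$ (coordinates in the order $s,w_0,w_1$). For $s\in\mathbb{R}$, $p\in T^2$ and $v\in\mathbb{Z}^2=H_1(T^2,\mathbb{Z})$ let $v_p(s)$ denote the closed geodesic $t\mapsto (s,\,p+tv)$, $0\le t\le 1$, in the torus fiber over $s$, regarded as a $1$-cycle in $M$. For disjoint $1$-cycles $\alpha,\beta$ in $M$ which are rational boundaries, the linking number is $\operatorname{Lk}(\alpha,\beta)=A\cdot\beta$, where $A$ is any smooth rational singular $2$-chain in $M$ with $\partial A=\alpha$ which is in general position to $\beta$ (the simplices of $A$ and of $\beta$ meet only at interior points and transversally), and $A\cdot\beta$ is the number of intersection points, counted with the coefficients and with the sign of the frame (oriented tangent frame of $A$, oriented tangent vector of $\beta$). Theorem. Let $a,b\in\mathbb{Z}^2=H_1(T^2,\mathbb{Z})$,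 $p,q\in T^2$, $s\in\mathbb{R}$ and $0<\varepsilon<1$. Then $f^{-1}-I$ is invertible over $\mathbb{Q}$; the cycles $a_p(s)$ and $b_q(s+\varepsilon)$ are disjoint and are rational boundaries in $M$; a $2$-chain $A$ as above exists for $\alpha=a_p(s)$, $\beta=b_q(s+\varepsilon)$; the number $A\cdot\beta$ does not depend on the choice of $A$; and $$\operatorname{Lk}\bigl(a_p(s),\,b_q(s+\varepsilon)\bigr)=\bigl\langle (f^{-1}-I)^{-1}a,\;b\bigr\rangle ,$$ where $\langle x,y\rangle=x_0y_1-x_1y_0$ is the symplectic intersection form on $H_1(T^2,\mathbb{Q})=\mathbb{Q}^2$. -/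

import Mathlib

open scoped MatrixGroups ContDiff

noncomputable section

namespace SolLinking

/-- The torus `T² = ℝ² / ℤ²`. -/
abbrev Torus : Type := Fin 2 → UnitAddCircle

/-- The projection `ℝ² → T²`. -/
def toTorus (w : Fin 2 → ℝ) : Torus := fun i => (w i : UnitAddCircle)

/-- The linear action of `g ∈ SL(2, ℤ)` on `T²` (matrix times column vector). -/
def torusMap (g : SL(2, ℤ)) (w : Torus) : Torus := fun i => ∑ j, g.1 i j • w j

theorem torusMap_one (w : Torus) : torusMap 1 w = w := by
  funext i
  fin_cases i <;> simp [torusMap, Fin.sum_univ_two]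

theorem torusMap_mul (g h : SL(2, ℤ)) (w : Torus) :
    torusMap (g * h) w = torusMap g (torusMap h w) := by
  funext i
  simp only [torusMap, Matrix.SpecialLinearGroup.coe_mul, Matrix.mul_apply, Fin.sum_univ_two,
    add_smul, mul_smul, smul_add]
  abel

/-- The equivalence relation on `ℝ × T²` generated by `(s, w) ∼ (s + 1, f w)`. -/
def gluing (f : SL(2, ℤ)) : Setoid (ℝ × Torus) where
  r x y := ∃ n : ℤ, y.1 = x.1 + n ∧ y.2 = torusMap (f ^ n) x.2
  iseqv :=
    { refl := fun x => ⟨0, by simp, by simp [torusMap_one]⟩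
      symm := by
        rintro x y ⟨n, h1, h2⟩
        refine ⟨-n, by rw [h1]; push_cast; ring, ?_⟩
        rw [h2, ← torusMap_mul, ← zpow_add, neg_add_cancel, zpow_zero, torusMap_one]
      trans := by
        rintro x y z ⟨n, h1, h2⟩ ⟨m, h3, h4⟩
        refine ⟨m + n, by rw [h3, h1]; push_cast; ring, ?_⟩
        rw [h4, h2, ← torusMap_mul, ← zpow_add] }

/-- The mapping torus `M = (ℝ × T²) / ((s, w) ∼ (s + 1, f w))`, with the quotient topology. -/
def SolManifold (f : SL(2, ℤ)) : Type := Quotient (gluing f)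

instance (f : SL(2, ℤ)) : TopologicalSpace (SolManifold f) :=
  inferInstanceAs (TopologicalSpace (Quotient (gluing f)))

/-- The infinite cyclic covering `ℝ × T² → M`. -/
def proj (f : SL(2, ℤ)) (x : ℝ × Torus) : SolManifold f := Quotient.mk (gluing f) x

theorem continuous_proj (f : SL(2, ℤ)) : Continuous (proj f) := continuous_quotient_mk'

/-- The universal covering `ℝ × ℝ² → M`. It is a local diffeomorphism, and orients `M` by the
standard orientation (order of coordinates `s, w₀, w₁`) of `ℝ × ℝ²`: the deck transformations
`(s, w) ↦ (s + n, f ^ n w + v)`, with `n` an integer and `v` an integral vector, preserve it. -/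
def univCover (f : SL(2, ℤ)) (x : ℝ × (Fin 2 → ℝ)) : SolManifold f := proj f (x.1, toTorus x.2)

/-! ### Singular chains with rational coefficients -/

variable {X : Type*} [TopologicalSpace X]

/-- Singular `k`-simplices of `X`. -/
abbrev Simplex (k : ℕ) (X : Type*) [TopologicalSpace X] : Type _ :=
  C(stdSimplex ℝ (Fin (k + 1)), X)

/-- Rational singular `k`-chains of `X`. -/
abbrev Chain (k : ℕ) (X : Type*) [TopologicalSpace X] : Type _ := Simplex k X →₀ ℚ

/-- The `i`-th face of a singular simplex (the one opposite to the `i`-th vertex). -/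
def face {k : ℕ} (i : Fin (k + 2)) (σ : Simplex (k + 1) X) : Simplex k X :=
  σ.comp ⟨stdSimplex.map i.succAbove, stdSimplex.continuous_map i.succAbove⟩

/-- The singular boundary operator `∂ σ = ∑ i, (-1)^i (i-th face of σ)`. -/
def boundary (k : ℕ) : Chain (k + 1) X →ₗ[ℚ] Chain k X :=
  Finsupp.linearCombination ℚ fun σ => ∑ i : Fin (k + 2), Finsupp.single (face i σ) ((-1) ^ (i : ℕ))

/-- The set of points of `X` on the simplices of a chain. -/
def carrier {k : ℕ} (c : Chain k X) : Set X := ⋃ σ ∈ c.support, Set.range σ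

/-! ### Smooth chains in `M` and their intersection numbers -/

variable {f : SL(2, ℤ)}

/-- `L` is a smooth lift of the singular simplex `σ` to the universal covering (a smooth map on
the standard simplex being one that extends smoothly to the ambient space). -/
def IsSmoothLift {k : ℕ} (σ : Simplex k (SolManifold f))
    (L : (Fin (k + 1) → ℝ) → ℝ × (Fin 2 → ℝ)) : Prop :=
  ContDiff ℝ ∞ L ∧ ∀ x : stdSimplex ℝ (Fin (k + 1)), univCover f (L x.1) = σ x

/-- Smooth chains: all simplices are smooth maps to `M`. As simplices are simply connected and
`univCover f` is a covering and a local diffeomorphism, a map to `M` is smooth if and only if it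
has a smooth lift. -/
def IsSmooth {k : ℕ} (c : Chain k (SolManifold f)) : Prop :=
  ∀ σ ∈ c.support, ∃ L, IsSmoothLift σ L

/-- The determinant of a triple of tangent vectors of `ℝ × ℝ²` in the coordinates `s, w₀, w₁`. -/
def frameDet (u v w : ℝ × (Fin 2 → ℝ)) : ℝ :=
  Matrix.det !![u.1, u.2 0, u.2 1; v.1, v.2 0, v.2 1; w.1, w.2 0, w.2 1]

/-- The edge vector from the `0`-th to the `i`-th vertex of the standard simplex. -/
def edge {k : ℕ} (i : Fin (k + 1)) : Fin (k + 1) → ℝ := Pi.single i 1 - Pi.single 0 1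

/-- The determinant of the oriented tangent frame of a `2`-simplex (lifted to `K`) at `x`, followed
by the oriented tangent vector of a `1`-simplex (lifted to `L`) at `t`. -/
def crossingDet (K : (Fin 3 → ℝ) → ℝ × (Fin 2 → ℝ)) (L : (Fin 2 → ℝ) → ℝ × (Fin 2 → ℝ))
    (x : Fin 3 → ℝ) (t : Fin 2 → ℝ) : ℝ :=
  frameDet (fderiv ℝ K x (edge 1)) (fderiv ℝ K x (edge 2)) (fderiv ℝ L t (edge 1))

/-- `σ x = τ t`, and `σ` and `τ` cross there transversally and positively. Lifts are compared at
a common point of the universal covering. -/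
def PosCrossing (σ : Simplex 2 (SolManifold f)) (τ : Simplex 1 (SolManifold f))
    (p : stdSimplex ℝ (Fin 3) × stdSimplex ℝ (Fin 2)) : Prop :=
  ∃ K L, IsSmoothLift σ K ∧ IsSmoothLift τ L ∧ K p.1.1 = L p.2.1 ∧
    0 < crossingDet K L p.1.1 p.2.1

/-- `σ x = τ t`, and `σ` and `τ` cross there transversally and negatively. -/
def NegCrossing (σ : Simplex 2 (SolManifold f)) (τ : Simplex 1 (SolManifold f))
    (p : stdSimplex ℝ (Fin 3) × stdSimplex ℝ (Fin 2)) : Prop :=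
  ∃ K L, IsSmoothLift σ K ∧ IsSmoothLift τ L ∧ K p.1.1 = L p.2.1 ∧
    crossingDet K L p.1.1 p.2.1 < 0

/-- `A` and `b` are in general position: their simplices meet only at interior points, and
transversally. By compactness they then meet in finitely many points only. -/
def GeneralPosition (A : Chain 2 (SolManifold f)) (b : Chain 1 (SolManifold f)) : Prop :=
  ∀ σ ∈ A.support, ∀ τ ∈ b.support, ∀ x t, σ x = τ t →
    (∀ i, 0 < x.1 i) ∧ (∀ i, 0 < t.1 i) ∧ (PosCrossing σ τ (x, t) ∨ NegCrossing σ τ (x, t))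

/-- The signed number of crossings of a `2`-simplex and a `1`-simplex. -/
def crossingNumber (σ : Simplex 2 (SolManifold f)) (τ : Simplex 1 (SolManifold f)) : ℚ :=
  (Set.ncard {p | PosCrossing σ τ p} : ℚ) - (Set.ncard {p | NegCrossing σ τ p} : ℚ)

/-- The intersection number `A · b` of chains in general position. -/
def intersectionNumber (A : Chain 2 (SolManifold f)) (b : Chain 1 (SolManifold f)) : ℚ :=
  A.sum fun σ m => b.sum fun τ n => m * n * crossingNumber σ τ

/-- The `1`-cycles `a` and `b` have the well-defined linking number `q`: they are disjoint, both
bound rationally, and `A · b = q` for every rational `2`-chain `A` with boundary `a` in general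
position to `b`, where such an `A` exists. -/
structure HasLinkingNumber (a b : Chain 1 (SolManifold f)) (q : ℚ) : Prop where
  disjoint : Disjoint (carrier a) (carrier b)
  bounds_left : ∃ A, IsSmooth A ∧ boundary 1 A = a
  bounds_right : ∃ B, IsSmooth B ∧ boundary 1 B = b
  exists_cap : ∃ A, IsSmooth A ∧ boundary 1 A = a ∧ GeneralPosition A b
  intersection_eq : ∀ A, IsSmooth A → boundary 1 A = a → GeneralPosition A b →
    intersectionNumber A b = q

/-! ### Closed geodesics in torus fibers -/

/-- The closed geodesic `t ↦ (s, p + t v)`, `0 ≤ t ≤ 1`, in the fiber of `M` over `s`, as a singular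
simplex. It starts at `p` and represents the class `v ∈ ℤ² = H₁(T², ℤ)`. -/
def geodesic (f : SL(2, ℤ)) (s : ℝ) (p : Torus) (v : Fin 2 → ℤ) : Simplex 1 (SolManifold f) where
  toFun t := proj f (s, p + toTorus fun i => t.1 1 * v i)
  continuous_toFun := by
    refine (continuous_proj f).comp (continuous_const.prodMk (continuous_const.add ?_))
    refine continuous_pi fun i => (AddCircle.continuous_mk' 1).comp ?_
    exact ((continuous_apply 1).comp continuous_subtype_val).mul continuous_const

/-- The closed geodesic as a `1`-cycle of `M`. -/
def geodesicCycle (f : SL(2, ℤ)) (s : ℝ) (p : Torus) (v : Fin 2 → ℤ) : Chain 1 (SolManifold f) :=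
  Finsupp.single (geodesic f s p v) 1

/-- The intersection form on `H₁(T², ℚ) = ℚ²`. -/
def symplecticForm (x y : Fin 2 → ℚ) : ℚ := x 0 * y 1 - x 1 * y 0

/-- The rational matrix `f⁻¹ - I`, acting on `H₁(T², ℚ) = ℚ²`. -/
def invSubOne (f : SL(2, ℤ)) : Matrix (Fin 2) (Fin 2) ℚ :=
  (f⁻¹).1.map (Int.cast : ℤ → ℚ) - 1

end SolLinking

end

/-! Existence of a cap. Work in the quotient of rational 1-chains by the boundaries of smooth
2-chains in general position to `β = b_q(s+ε)`. Triangles in the fiber over `s` miss `β`, so closed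
geodesics in that fiber define a class `Φ v` that is additive in `v` and independent of the base
point (`exists_fiberClass`). The annulus swept by a geodesic `x` from level `s` to level `s+1`, cut
into two triangles and started at a generic point, crosses `β` only transversally; the gluing turns
its upper end into `f⁻¹ x` over `s`, so `Φ (f⁻¹ x) = Φ x`. For `x = (f - I) a` Cayley-Hamilton gives
`f⁻¹ x - x = (2 - tr f) a`, hence `(2 - tr f) Φ a = 0`. Hyperbolicity excludes `tr f = 2`, and the
quotient is a rational vector space, so `Φ a = 0` (`geodesicCycle_mem_capBoundaries`).

Value and independence of the cap. Let `c = ⟨(f⁻¹ - I)⁻¹ ·, b⟩`, so that `c ∘ f⁻¹ - c = ⟨·, b⟩`. For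
small `r > 0` a C¹ 1-form on the universal cover is built from `c`, a plateau in the `s`-direction
and a periodic sawtooth in the direction `⟨w, b⟩`. Its differential is a telescoping term plus a
density times `ds ∧ ⟨dw, b⟩`, the density being concentrated near the lifts of `β` (`curl_form`).
After summation over the deck transformations `deck f n` the telescoping term vanishes, so the sum
is a primitive of a form dual to `β`.

By Stokes the integral of this sum over `∂A` is the integral of the density over `A`. At each
transversal crossing the local contribution is a sign times `d = gcd(b₀, b₁)`, which is also the
number of parameters at which the geodesic passes through that point. Hence for small `r` the
integral equals `A · β` exactly (`eventually_chainPairing_boundary`). Over `∂A = a_p(s)` only one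
translate meets the plateau, and it contributes `c a` (`eventually_chainPairing_geodesic`). Thus `A
· β = c a` for every admissible `A`. The case `b = 0`, where `d` would vanish, is separate: no
crossing with a constant curve is transversal. -/

noncomputable section

namespace SolLinking

/-! ### Deck transformations -/

/-- The linear action of `g ∈ SL(2, ℤ)` on `ℝ²`. -/
def linMap (g : SL(2, ℤ)) : (Fin 2 → ℝ) →L[ℝ] (Fin 2 → ℝ) :=
  LinearMap.toContinuousLinearMap (Matrix.toLin' (g.1.map (Int.cast : ℤ → ℝ)))

theorem linMap_apply (g : SL(2, ℤ)) (w : Fin 2 → ℝ) (i : Fin 2) :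
    linMap g w i = g.1 i 0 * w 0 + g.1 i 1 * w 1 := by
  simp [linMap, Matrix.toLin'_apply, Matrix.mulVec, dotProduct, Fin.sum_univ_two]

theorem linMap_one (w : Fin 2 → ℝ) : linMap 1 w = w := by
  funext i
  fin_cases i <;> simp [linMap_apply]

theorem linMap_mul (g h : SL(2, ℤ)) (w : Fin 2 → ℝ) :
    linMap (g * h) w = linMap g (linMap h w) := by
  funext i
  simp only [linMap_apply, Matrix.SpecialLinearGroup.coe_mul, Matrix.mul_apply, Fin.sum_univ_two]
  push_cast
  ring

theorem toTorus_add (w v : Fin 2 → ℝ) : toTorus (w + v) = toTorus w + toTorus v := by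
  funext i
  simp [toTorus]

theorem toTorus_linMap (g : SL(2, ℤ)) (w : Fin 2 → ℝ) :
    toTorus (linMap g w) = torusMap g (toTorus w) := by
  funext i
  simp only [toTorus, torusMap, linMap_apply, Fin.sum_univ_two]
  rw [AddCircle.coe_add, ← zsmul_eq_mul, ← zsmul_eq_mul, AddCircle.coe_zsmul, AddCircle.coe_zsmul]

theorem toTorus_surjective : Function.Surjective toTorus := fun p => by
  choose w hw using fun i => QuotientAddGroup.mk_surjective (p i)
  exact ⟨w, funext hw⟩

/-- The real vector of an integral one. -/
def intVec (v : Fin 2 → ℤ) : Fin 2 → ℝ := fun i => v i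

theorem intVec_add (v w : Fin 2 → ℤ) : intVec (v + w) = intVec v + intVec w := by
  funext i; simp [intVec]

theorem toTorus_eq_iff (w w' : Fin 2 → ℝ) :
    toTorus w = toTorus w' ↔ ∃ v : Fin 2 → ℤ, w' = w + intVec v := by
  constructor
  · intro h
    have h1 : ∀ i, ∃ n : ℤ, w' i = w i + n := fun i => by
      have := congrFun h i
      simp only [toTorus] at this
      obtain ⟨n, hn⟩ := AddSubgroup.mem_zmultiples_iff.1 (QuotientAddGroup.eq.1 this)
      exact ⟨n, by simp only [zsmul_eq_mul, mul_one] at hn; linarith⟩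
    choose v hv using h1
    exact ⟨v, funext hv⟩
  · rintro ⟨v, rfl⟩
    funext i
    simp [toTorus, intVec]

/-- The deck transformation `(s, w) ↦ (s + n, f ^ n w)`. -/
def deck (f : SL(2, ℤ)) (n : ℤ) (x : ℝ × (Fin 2 → ℝ)) : ℝ × (Fin 2 → ℝ) :=
  (x.1 + n, linMap (f ^ n) x.2)

theorem deck_zero (f : SL(2, ℤ)) (x : ℝ × (Fin 2 → ℝ)) : deck f 0 x = x := by
  simp [deck, linMap_one]

theorem deck_deck (f : SL(2, ℤ)) (m n : ℤ) (x : ℝ × (Fin 2 → ℝ)) :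
    deck f m (deck f n x) = deck f (m + n) x := by
  simp only [deck, zpow_add, linMap_mul, Prod.mk.injEq, and_true]
  push_cast
  ring

theorem univCover_eq_iff (f : SL(2, ℤ)) (x y : ℝ × (Fin 2 → ℝ)) :
    univCover f x = univCover f y ↔
      ∃ (n : ℤ) (v : Fin 2 → ℤ), y = deck f n x + (0, intVec v) := by
  have h0 : univCover f x = univCover f y ↔
      ∃ n : ℤ, y.1 = x.1 + n ∧ toTorus y.2 = torusMap (f ^ n) (toTorus x.2) := Quotient.eq
  rw [h0]
  refine exists_congr fun n => ?_
  rw [← toTorus_linMap, eq_comm (a := toTorus y.2), toTorus_eq_iff]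
  constructor
  · rintro ⟨h1, v, h2⟩
    exact ⟨v, Prod.ext (by simp [deck, h1]) (by simp [deck, h2])⟩
  · rintro ⟨v, rfl⟩
    exact ⟨by simp [deck], v, by simp [deck]⟩

theorem univCover_deck (f : SL(2, ℤ)) (n : ℤ) (x : ℝ × (Fin 2 → ℝ)) :
    univCover f (deck f n x) = univCover f x :=
  ((univCover_eq_iff f _ _).2 ⟨n, 0, by ext <;> simp [intVec]⟩).symm

theorem univCover_add_intVec (f : SL(2, ℤ)) (x : ℝ × (Fin 2 → ℝ)) (v : Fin 2 → ℤ) :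
    univCover f (x + (0, intVec v)) = univCover f x :=
  ((univCover_eq_iff f _ _).2 ⟨0, v, by rw [deck_zero]⟩).symm

theorem contDiff_deck (f : SL(2, ℤ)) (n : ℤ) : ContDiff ℝ ∞ (deck f n) :=
  (contDiff_fst.add contDiff_const).prodMk ((linMap (f ^ n)).contDiff.comp contDiff_snd)

theorem continuous_univCover (f : SL(2, ℤ)) : Continuous (univCover f) := by
  refine (continuous_proj f).comp (continuous_fst.prodMk (continuous_pi fun i => ?_))
  exact (AddCircle.continuous_mk' 1).comp ((continuous_apply i).comp continuous_snd)

/-! ### Lifts of simplices -/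

/-- A continuous function with integral values at each point of a preconnected set is constant. -/
theorem exists_int_const {X : Type*} [TopologicalSpace X] {S : Set X} (hS : IsPreconnected S)
    {g : X → ℝ} (hg : ContinuousOn g S) (h : ∀ x ∈ S, ∃ n : ℤ, g x = n) :
    ∃ n : ℤ, ∀ x ∈ S, g x = n := by
  rcases S.eq_empty_or_nonempty with rfl | ⟨x0, hx0⟩
  · exact ⟨0, by simp⟩
  obtain ⟨n, hn⟩ := h x0 hx0
  refine ⟨n, fun x hx => ?_⟩
  obtain ⟨m, hm⟩ := h x hx
  rw [← hn]
  by_contra hne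
  have hT : (g '' S).OrdConnected := (hS.image g hg).ordConnected
  have key : ∀ i j : ℤ, (i : ℝ) ∈ g '' S → (j : ℝ) ∈ g '' S → i < j → False := by
    intro i j hi hj hij
    have hij' : (i : ℝ) + 1 ≤ j := by exact_mod_cast hij
    obtain ⟨y, hy, hy'⟩ := hT.out hi hj (show (i : ℝ) + 1 / 2 ∈ Set.Icc (i : ℝ) j from
      ⟨by linarith, by linarith⟩)
    obtain ⟨k, hk⟩ := h y hy
    rw [hk] at hy'
    have h1 : (i : ℝ) < k := by linarith
    have h2 : (k : ℝ) < (i + 1 : ℤ) := by push_cast; linarith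
    have h1' : i < k := by exact_mod_cast h1
    have h2' : k < i + 1 := by exact_mod_cast h2
    omega
  have hxm : (m : ℝ) ∈ g '' S := ⟨x, hx, hm⟩
  have hxn : (n : ℝ) ∈ g '' S := ⟨x0, hx0, hn⟩
  rcases lt_trichotomy m n with hmn | hmn | hmn
  · exact key _ _ hxm hxn hmn
  · exact hne (by rw [hm, hn, hmn])
  · exact key _ _ hxn hxm hmn

/-- Two lifts of a simplex differ by a deck transformation. -/
theorem exists_deck_of_lifts {f : SL(2, ℤ)} {k : ℕ} {σ : Simplex k (SolManifold f)}
    {K L : (Fin (k + 1) → ℝ) → ℝ × (Fin 2 → ℝ)} (hK : IsSmoothLift σ K) (hL : IsSmoothLift σ L) :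
    ∃ (n : ℤ) (v : Fin 2 → ℤ), ∀ x ∈ stdSimplex ℝ (Fin (k + 1)),
      L x = deck f n (K x) + (0, intVec v) := by
  have hc : IsPreconnected (stdSimplex ℝ (Fin (k + 1))) :=
    (convex_stdSimplex ℝ _).isPreconnected
  have h : ∀ x ∈ stdSimplex ℝ (Fin (k + 1)), ∃ (n : ℤ) (v : Fin 2 → ℤ),
      L x = deck f n (K x) + (0, intVec v) := fun x hx =>
    (univCover_eq_iff f _ _).1 ((hK.2 ⟨x, hx⟩).trans (hL.2 ⟨x, hx⟩).symm)
  have hKc := hK.1.continuous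
  have hLc := hL.1.continuous
  obtain ⟨n, hn⟩ := exists_int_const hc (g := fun x => (L x).1 - (K x).1)
    (by fun_prop) fun x hx => by
      obtain ⟨n, v, h⟩ := h x hx
      exact ⟨n, by rw [h]; simp [deck]⟩
  have h2 : ∀ x ∈ stdSimplex ℝ (Fin (k + 1)), ∃ v : Fin 2 → ℤ,
      L x = deck f n (K x) + (0, intVec v) := fun x hx => by
    obtain ⟨m, v, h⟩ := h x hx
    have h3 := hn x hx
    have : m = n := by
      rw [h] at h3
      simp only [deck, Prod.fst_add, add_zero] at h3
      have : (m : ℝ) = n := by linarith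
      exact_mod_cast this
    exact ⟨v, this ▸ h⟩
  have h4 : ∀ i, ∃ m : ℤ, ∀ x ∈ stdSimplex ℝ (Fin (k + 1)),
      (L x).2 i - linMap (f ^ n) (K x).2 i = m := fun i => by
    refine exists_int_const hc (by fun_prop) fun x hx => ?_
    obtain ⟨v, h⟩ := h2 x hx
    exact ⟨v i, by rw [h]; simp [deck, intVec]⟩
  choose v hv using h4
  refine ⟨n, v, fun x hx => Prod.ext ?_ (funext fun i => ?_)⟩
  · have := hn x hx
    simp only [deck, Prod.fst_add, add_zero]
    linarith
  · have := hv i x hx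
    simp only [deck, Prod.snd_add, Pi.add_apply, intVec]
    linarith

theorem IsSmoothLift.deck_add {f : SL(2, ℤ)} {k : ℕ} {σ : Simplex k (SolManifold f)}
    {K : (Fin (k + 1) → ℝ) → ℝ × (Fin 2 → ℝ)} (hK : IsSmoothLift σ K) (n : ℤ) (v : Fin 2 → ℤ) :
    IsSmoothLift σ fun x => deck f n (K x) + (0, intVec v) :=
  ⟨((contDiff_deck f n).comp hK.1).add contDiff_const, fun x => by
    rw [univCover_add_intVec, univCover_deck, hK.2]⟩

/-- The standard lift of a closed geodesic. -/
def geodesicLift (s : ℝ) (p : Fin 2 → ℝ) (v : Fin 2 → ℤ) (t : Fin 2 → ℝ) : ℝ × (Fin 2 → ℝ) :=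
  (s, p + t 1 • intVec v)

theorem isSmoothLift_geodesicLift (f : SL(2, ℤ)) (s : ℝ) (p : Fin 2 → ℝ) (v : Fin 2 → ℤ) :
    IsSmoothLift (geodesic f s (toTorus p) v) (geodesicLift s p v) := by
  refine ⟨?_, fun x => ?_⟩
  · exact contDiff_const.prodMk (contDiff_const.add
      (((contDiff_apply ℝ ℝ (1 : Fin 2))).smul contDiff_const))
  · simp only [univCover, geodesicLift, toTorus_add]
    rfl

end SolLinking

end

/-! ### Densities concentrated on a lattice in the plane -/

noncomputable section

namespace SolLinking

open MeasureTheory Set Filter Topology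

/-! ### Bump functions -/

/-- A smooth step function, increasing from `0` to `1` on `[-r, r]`. -/
def step (r x : ℝ) : ℝ := Real.smoothTransition ((x + r) / (2 * r))

/-- A smooth bump function with integral `1`, supported in `[-r, r]`. -/
def bump (r : ℝ) : ℝ → ℝ := deriv (step r)

theorem contDiff_step (r : ℝ) : ContDiff ℝ ∞ (step r) :=
  Real.smoothTransition.contDiff.comp ((contDiff_id.add contDiff_const).div_const _)

theorem contDiff_bump (r : ℝ) : ContDiff ℝ ∞ (bump r) :=
  ((contDiff_infty_iff_deriv).1 (contDiff_step r)).2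

theorem hasDerivAt_step (r x : ℝ) : HasDerivAt (step r) (bump r x) x :=
  ((contDiff_step r).differentiable (by simp) x).hasDerivAt

theorem step_of_le {r x : ℝ} (hr : 0 < r) (hx : x ≤ -r) : step r x = 0 :=
  Real.smoothTransition.zero_of_nonpos
    (div_nonpos_of_nonpos_of_nonneg (by linarith) (by linarith))

theorem step_of_ge {r x : ℝ} (hr : 0 < r) (hx : r ≤ x) : step r x = 1 :=
  Real.smoothTransition.one_of_one_le ((one_le_div (by linarith)).2 (by linarith))

theorem bump_of_lt_abs {r x : ℝ} (hr : 0 < r) (hx : r < |x|) : bump r x = 0 := by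
  rcases lt_abs.1 hx with h | h
  · have : step r =ᶠ[𝓝 x] fun _ => 1 := by
      filter_upwards [lt_mem_nhds h] with y hy using step_of_ge hr hy.le
    rw [bump, this.deriv_eq, deriv_const]
  · have : step r =ᶠ[𝓝 x] fun _ => 0 := by
      filter_upwards [gt_mem_nhds (show x < -r by linarith)] with y hy using step_of_le hr hy.le
    rw [bump, this.deriv_eq, deriv_const]

theorem integral_bump {r : ℝ} (hr : 0 < r) (hr1 : r < 1) : ∫ x in (-1 : ℝ)..1, bump r x = 1 := by
  rw [intervalIntegral.integral_eq_sub_of_hasDerivAt (fun x _ => hasDerivAt_step r x)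
    ((contDiff_bump r).continuous.intervalIntegrable _ _), step_of_ge hr hr1.le,
    step_of_le hr (by linarith), sub_zero]

/-- A nonnegative continuous `d`-periodic function supported near `d ℤ`. -/
def sineBump (d r y : ℝ) : ℝ := max 0 (r - |Real.sin (Real.pi * y / d)|)

/-- A `d`-periodic continuous function supported near `d ℤ` with integral `d` over a period. -/
def periodicBump (d r y : ℝ) : ℝ := d / (∫ t in (0 : ℝ)..d, sineBump d r t) * sineBump d r y

theorem continuous_sineBump (d r : ℝ) : Continuous (sineBump d r) := by
  unfold sineBump
  fun_prop

theorem continuous_periodicBump (d r : ℝ) : Continuous (periodicBump d r) :=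
  continuous_const.mul (continuous_sineBump d r)

theorem periodic_sineBump {d : ℝ} (hd : 0 < d) (r : ℝ) : Function.Periodic (sineBump d r) d := by
  intro y
  have : Real.pi * (y + d) / d = Real.pi * y / d + Real.pi := by field_simp
  rw [sineBump, this, Real.sin_add_pi, abs_neg, sineBump]

theorem periodic_periodicBump {d : ℝ} (hd : 0 < d) (r : ℝ) :
    Function.Periodic (periodicBump d r) d := fun y => by
  rw [periodicBump, periodic_sineBump hd, periodicBump]

theorem periodicBump_eq_zero {d r y : ℝ} (h : r ≤ |Real.sin (Real.pi * y / d)|) :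
    periodicBump d r y = 0 := by
  rw [periodicBump, sineBump, max_eq_left (by linarith), mul_zero]

theorem integral_periodicBump {d r : ℝ} (hd : 0 < d) (hr : 0 < r) (y : ℝ) :
    ∫ t in y..y + d, periodicBump d r t = d := by
  rw [(periodic_periodicBump hd r).intervalIntegral_add_eq y 0, zero_add]
  simp only [periodicBump, intervalIntegral.integral_const_mul]
  refine div_mul_cancel₀ _ (ne_of_gt ?_)
  refine intervalIntegral.integral_pos hd (continuous_sineBump d r).continuousOn
    (fun x _ => le_max_left _ _) ⟨0, ⟨le_rfl, hd.le⟩, ?_⟩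
  simp [sineBump, hr]

/-- The periodic primitive of `periodicBump - 1`. -/
def sawtooth (d r y : ℝ) : ℝ := ∫ t in (0 : ℝ)..y, (periodicBump d r t - 1)

theorem hasDerivAt_sawtooth (d r y : ℝ) :
    HasDerivAt (sawtooth d r) (periodicBump d r y - 1) y :=
  intervalIntegral.integral_hasDerivAt_right
    (((continuous_periodicBump d r).sub continuous_const).intervalIntegrable _ _)
    ((continuous_periodicBump d r).sub continuous_const).aestronglyMeasurable.stronglyMeasurableAtFilter
    ((continuous_periodicBump d r).sub continuous_const).continuousAt

/-- The truncation in `sineBump` is only continuous, so its primitive is asserted to be C¹ and no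
more; this suffices for Stokes' theorem. -/
theorem contDiff_sawtooth (d r : ℝ) : ContDiff ℝ 1 (sawtooth d r) := by
  refine contDiff_one_iff_deriv.2 ⟨fun y => (hasDerivAt_sawtooth d r y).differentiableAt, ?_⟩
  have : deriv (sawtooth d r) = fun y => periodicBump d r y - 1 :=
    funext fun y => (hasDerivAt_sawtooth d r y).deriv
  rw [this]
  exact (continuous_periodicBump d r).sub continuous_const

/-- `periodicBump` has mean one over a period, so subtracting `1` leaves an integrand of mean zero.
-/
theorem periodic_sawtooth {d r : ℝ} (hd : 0 < d) (hr : 0 < r) :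
    Function.Periodic (sawtooth d r) d := fun y => by
  have hc : Continuous fun t => periodicBump d r t - 1 :=
    (continuous_periodicBump d r).sub continuous_const
  have h := intervalIntegral.integral_add_adjacent_intervals
    (hc.intervalIntegrable (μ := volume) 0 y) (hc.intervalIntegrable y (y + d))
  have h0 : ∫ t in y..y + d, (periodicBump d r t - 1) = 0 := by
    rw [intervalIntegral.integral_sub
      ((continuous_periodicBump d r).intervalIntegrable _ _) (by simp), integral_periodicBump hd hr]
    simp
  rw [sawtooth, ← h, h0, add_zero, sawtooth]

/-! ### Counting zeros by an integral -/

/-- The lattice `{0} × d ℤ` in the plane. -/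
def lattice (d : ℝ) : Set (ℝ × ℝ) := {y | y.1 = 0 ∧ Real.sin (Real.pi * y.2 / d) = 0}

theorem mem_lattice {d : ℝ} (hd : 0 < d) (y : ℝ × ℝ) :
    y ∈ lattice d ↔ y.1 = 0 ∧ ∃ k : ℤ, y.2 = k * d := by
  simp only [lattice, mem_ofPred_eq, Real.sin_eq_zero_iff]
  refine and_congr_right fun _ => exists_congr fun k => ?_
  rw [eq_div_iff hd.ne', mul_right_comm, mul_comm _ Real.pi, mul_right_inj' Real.pi_ne_zero, eq_comm]

theorem isClosed_lattice (d : ℝ) : IsClosed (lattice d) :=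
  (isClosed_eq continuous_fst continuous_const).inter
    (isClosed_eq (by fun_prop) continuous_const)

/-- A planar density concentrated near the lattice `{0} × d ℤ`. -/
def density (d r : ℝ) (y : ℝ × ℝ) : ℝ := bump r y.1 * periodicBump d r y.2

theorem continuous_density (d r : ℝ) : Continuous (density d r) :=
  ((contDiff_bump r).continuous.comp continuous_fst).mul
    ((continuous_periodicBump d r).comp continuous_snd)

/-- The function `max |y.1| |sin (π y.2 / d)|` vanishes exactly on the lattice, so it has a positive
minimum on `C`; every positive `r` below that minimum works. -/
theorem eventually_density_eq_zero {d : ℝ} {C : Set (ℝ × ℝ)} (hC : IsCompact C)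
    (h : Disjoint C (lattice d)) : ∀ᶠ r in 𝓝[>] (0 : ℝ), ∀ y ∈ C, density d r y = 0 := by
  rcases C.eq_empty_or_nonempty with rfl | hne
  · simp
  obtain ⟨y0, hy0, hmin⟩ := hC.exists_isMinOn hne
    (f := fun y : ℝ × ℝ => max |y.1| |Real.sin (Real.pi * y.2 / d)|)
    (Continuous.continuousOn (by fun_prop))
  have hpos : 0 < max |y0.1| |Real.sin (Real.pi * y0.2 / d)| := by
    by_contra hle
    have := max_le_iff.1 (not_lt.1 hle)
    exact Set.disjoint_left.1 h hy0 ⟨abs_nonpos_iff.1 this.1, abs_nonpos_iff.1 this.2⟩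
  filter_upwards [Ioo_mem_nhdsGT hpos] with r hr y hy
  have := hr.2.trans_le (hmin hy)
  rcases lt_max_iff.1 this with h1 | h1
  · rw [density, bump_of_lt_abs hr.1 h1, zero_mul]
  · rw [density, periodicBump_eq_zero h1.le, mul_zero]

/-- A box one period wide around `y` contains no other lattice point, and Fubini gives total mass `1
* d` on it. For small `r` all of this mass lies in any prescribed neighbourhood `V`. -/
theorem exists_nhds_integral_density {d : ℝ} (hd : 0 < d) {y : ℝ × ℝ} (hy : y ∈ lattice d) :
    ∃ W, IsOpen W ∧ y ∈ W ∧ W ∩ lattice d ⊆ {y} ∧ ∀ V ⊆ W, IsOpen V → y ∈ V →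
      ∀ᶠ r in 𝓝[>] (0 : ℝ), ∫ z in V, density d r z = d := by
  set S : Set (ℝ × ℝ) := Icc (-1) 1 ×ˢ Icc (y.2 - d / 2) (y.2 - d / 2 + d) with hS
  have hSl : S ∩ lattice d ⊆ {y} := by
    rintro z ⟨⟨h1, h2⟩, hz⟩
    rw [mem_lattice hd] at hz hy
    obtain ⟨hy1, k, hk⟩ := hy
    obtain ⟨hz1, l, hl⟩ := hz
    rw [hk, hl] at h2
    have h3 : (k : ℝ) - 1 / 2 ≤ l := by
      have := h2.1; by_contra hlt; nlinarith [not_le.1 hlt]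
    have h4 : (l : ℝ) ≤ k + 1 / 2 := by
      have := h2.2; by_contra hlt; nlinarith [not_le.1 hlt]
    have h5 : (k : ℝ) < l + 1 := by linarith
    have h6 : (l : ℝ) < k + 1 := by linarith
    have : l = k := by
      have h5' : k < l + 1 := by exact_mod_cast h5
      have h6' : l < k + 1 := by exact_mod_cast h6
      omega
    exact Prod.ext (hz1.trans hy1.symm) (by rw [hl, hk, this])
  set W : Set (ℝ × ℝ) := Ioo (-1) 1 ×ˢ Ioo (y.2 - d / 2) (y.2 - d / 2 + d) with hW
  have hWS : W ⊆ S := prod_mono Ioo_subset_Icc_self Ioo_subset_Icc_self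
  have hyW : y ∈ W := by
    refine ⟨?_, ?_⟩
    · rw [((mem_lattice hd y).1 hy).1]; norm_num
    · constructor <;> linarith
  refine ⟨W, isOpen_Ioo.prod isOpen_Ioo, hyW, (inter_subset_inter_left _ hWS).trans hSl,
    fun V hVW hV hyV => ?_⟩
  have hcomp : IsCompact (S \ V) := (isCompact_Icc.prod isCompact_Icc).diff hV
  have hdisj : Disjoint (S \ V) (lattice d) := by
    refine Set.disjoint_left.2 fun z hz hz' => hz.2 ?_
    rw [hSl ⟨hz.1, hz'⟩]
    exact hyV
  -- The bound `r < 1` puts the support of `bump r` inside `[-1, 1]`, the first side of the box.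
  filter_upwards [eventually_density_eq_zero hcomp hdisj, Ioo_mem_nhdsGT one_pos] with r hr hr1
  rw [← setIntegral_eq_of_subset_of_forall_sdiff_eq_zero
    (measurableSet_Icc.prod measurableSet_Icc) (hVW.trans hWS) hr]
  have := setIntegral_prod_mul (μ := (volume : Measure ℝ)) (ν := (volume : Measure ℝ)) (bump r) (periodicBump d r) (Icc (-1) 1)
    (Icc (y.2 - d / 2) (y.2 - d / 2 + d))
  rw [← Measure.volume_eq_prod] at this
  simp only [density]
  rw [this, integral_Icc_eq_integral_Ioc, integral_Icc_eq_integral_Ioc,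
    ← intervalIntegral.integral_of_le (by norm_num), ← intervalIntegral.integral_of_le (by linarith),
    integral_bump hr1.1 hr1.2, integral_periodicBump hd hr1.1, one_mul]

end SolLinking

end

/-! ### Signed zero counts as integrals, and Stokes on a square -/

noncomputable section

namespace SolLinking

open MeasureTheory Set Filter Topology

/-- A nondegenerate zero has a neighbourhood whose open subsets each contribute `± d`. -/
theorem exists_nhds_integral_density_comp {d : ℝ} (hd : 0 < d) {G : ℝ × ℝ → ℝ × ℝ}
    (hG : ContDiff ℝ 1 G) {z : ℝ × ℝ} (hz : G z ∈ lattice d) (hdet : (fderiv ℝ G z).det ≠ 0) :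
    ∃ U, IsOpen U ∧ z ∈ U ∧ U ∩ G ⁻¹' lattice d ⊆ {z} ∧ ∀ V ⊆ U, IsOpen V → z ∈ V →
      ∀ᶠ r in 𝓝[>] (0 : ℝ), ∫ x in V, density d r (G x) * (fderiv ℝ G x).det =
        d * SignType.sign (fderiv ℝ G z).det := by
  obtain ⟨W, hW, hzW, hWl, hWi⟩ := exists_nhds_integral_density hd hz
  have hs : HasStrictFDerivAt G
      (((fderiv ℝ G z).toContinuousLinearEquivOfDetNeZero hdet : (ℝ × ℝ) ≃L[ℝ] (ℝ × ℝ)) :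
        (ℝ × ℝ) →L[ℝ] (ℝ × ℝ)) z := by
    rw [ContinuousLinearMap.coe_toContinuousLinearEquivOfDetNeZero]
    exact hG.contDiffAt.hasStrictFDerivAt one_ne_zero
  set e := hs.toOpenPartialHomeomorph G with he
  have hcoe : (e : ℝ × ℝ → ℝ × ℝ) = G := hs.toOpenPartialHomeomorph_coe
  have hdc : Continuous fun x => (fderiv ℝ G x).det :=
    ContinuousLinearMap.continuous_det.comp (hG.continuous_fderiv one_ne_zero)
  set δ := (fderiv ℝ G z).det
  -- On this set the Jacobian keeps the sign it has at `z`, so the absolute value in the change of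
  -- variables can be replaced by a constant sign.
  have hsign : IsOpen {x | 0 < δ * (fderiv ℝ G x).det} :=
    isOpen_lt continuous_const (continuous_const.mul hdc)
  refine ⟨e.source ∩ G ⁻¹' W ∩ {x | 0 < δ * (fderiv ℝ G x).det},
    (e.open_source.inter (hW.preimage hG.continuous)).inter hsign,
    ⟨⟨hs.mem_toOpenPartialHomeomorph_source, hzW⟩, mul_self_pos.2 hdet⟩, ?_, ?_⟩
  · rintro x ⟨⟨⟨hx, hxW⟩, -⟩, hxl⟩
    have : G x = G z := hWl ⟨hxW, hxl⟩
    refine e.injOn hx hs.mem_toOpenPartialHomeomorph_source ?_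
    rw [hcoe, this]
  · intro V hVU hV hzV
    have hinj : InjOn G V := by
      rw [← hcoe]
      exact e.injOn.mono fun x hx => (hVU hx).1.1
    have hopen : IsOpen (G '' V) := by
      rw [← hcoe]
      exact e.isOpen_image_of_subset_source hV fun x hx => (hVU hx).1.1
    filter_upwards [hWi (G '' V) (by rintro _ ⟨x, hx, rfl⟩; exact (hVU hx).1.2) hopen
      ⟨z, hzV, rfl⟩] with r hr
    rw [integral_image_eq_integral_abs_det_fderiv_smul volume hV.measurableSet
      (fun x _ => ((hG.differentiable one_ne_zero) x).hasFDerivAt.hasFDerivWithinAt) hinj] at hr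
    have key : ∀ x ∈ V, density d r (G x) * (fderiv ℝ G x).det =
        |(fderiv ℝ G x).det| • density d r (G x) * SignType.sign δ := by
      intro x hx
      have h0 : 0 < δ * (fderiv ℝ G x).det := (hVU hx).2
      have h1 : SignType.sign δ = SignType.sign (fderiv ℝ G x).det := by
        rcases pos_and_pos_or_neg_and_neg_of_mul_pos h0 with h | h
        · rw [sign_pos h.1, sign_pos h.2]
        · rw [sign_neg h.1, sign_neg h.2]
      rw [h1, smul_eq_mul]
      nth_rw 1 [← abs_mul_sign (fderiv ℝ G x).det]
      ring
    rw [setIntegral_congr_fun hV.measurableSet key, integral_mul_const, hr]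

/-- The zeros of a planar map, all of them interior and nondegenerate, are counted by the integral
of a density concentrated at the lattice. -/
theorem eventually_integral_density_eq {d : ℝ} (hd : 0 < d) {G : ℝ × ℝ → ℝ × ℝ}
    (hG : ContDiff ℝ 1 G)
    (h : ∀ z ∈ Icc (0 : ℝ × ℝ) 1, G z ∈ lattice d →
      z ∈ interior (Icc (0 : ℝ × ℝ) 1) ∧ (fderiv ℝ G z).det ≠ 0) :
    {z ∈ Icc (0 : ℝ × ℝ) 1 | G z ∈ lattice d}.Finite ∧
    ∀ᶠ r in 𝓝[>] (0 : ℝ), ∫ z in Icc (0 : ℝ × ℝ) 1, density d r (G z) * (fderiv ℝ G z).det =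
      d * (({z ∈ Icc (0 : ℝ × ℝ) 1 | G z ∈ lattice d ∧ 0 < (fderiv ℝ G z).det}.ncard : ℝ) -
        {z ∈ Icc (0 : ℝ × ℝ) 1 | G z ∈ lattice d ∧ (fderiv ℝ G z).det < 0}.ncard) := by
  set Q : Set (ℝ × ℝ) := Icc 0 1 with hQ
  set Z := {z ∈ Q | G z ∈ lattice d} with hZ
  have hQc : IsCompact Q := isCompact_Icc
  have hZc : IsCompact Z := hQc.inter_right ((isClosed_lattice d).preimage hG.continuous)
  have hloc : ∀ z : ℝ × ℝ, ∃ U, z ∈ Z → IsOpen U ∧ z ∈ U ∧ U ∩ G ⁻¹' lattice d ⊆ {z} ∧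
      ∀ V ⊆ U, IsOpen V → z ∈ V →
      ∀ᶠ r in 𝓝[>] (0 : ℝ), ∫ x in V, density d r (G x) * (fderiv ℝ G x).det =
        d * SignType.sign (fderiv ℝ G z).det := fun z => by
    by_cases hz : z ∈ Z
    · obtain ⟨U, hU⟩ := exists_nhds_integral_density_comp hd hG hz.2 (h z hz.1 hz.2).2
      exact ⟨U, fun _ => hU⟩
    · exact ⟨∅, fun h => absurd h hz⟩
  choose U hU using hloc
  -- Nondegenerate zeros are isolated, and the zero set is compact.
  have hfin : Z.Finite := by
    obtain ⟨t, ht, htZ⟩ := hZc.elim_nhds_subcover U fun z hz => (hU z hz).1.mem_nhds (hU z hz).2.1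
    refine t.finite_toSet.subset fun z hz => ?_
    obtain ⟨y, hy, hzy⟩ := mem_iUnion₂.1 (htZ hz)
    have : z = y := (hU y (ht y hy)).2.2.1 ⟨hzy, hz.2⟩
    exact this ▸ hy
  refine ⟨hfin, ?_⟩
  obtain ⟨N, hN, hNd⟩ := hfin.t2_separation
  set V : ℝ × ℝ → Set (ℝ × ℝ) := fun z => U z ∩ N z ∩ interior Q with hV
  have hVo : ∀ z ∈ Z, IsOpen (V z) := fun z hz =>
    ((hU z hz).1.inter (hN z).2).inter isOpen_interior
  have hzV : ∀ z ∈ Z, z ∈ V z := fun z hz =>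
    ⟨⟨(hU z hz).2.1, (hN z).1⟩, (h z hz.1 hz.2).1⟩
  have hVQ : ∀ z, V z ⊆ Q := fun z => inter_subset_right.trans interior_subset
  have hev1 : ∀ᶠ r in 𝓝[>] (0 : ℝ), ∀ z ∈ Z,
      ∫ x in V z, density d r (G x) * (fderiv ℝ G x).det =
        d * SignType.sign (fderiv ℝ G z).det :=
    (eventually_all_finite hfin).2 fun z hz =>
      (hU z hz).2.2.2 (V z) (fun x hx => hx.1.1) (hVo z hz) (hzV z hz)
  set O := ⋃ z ∈ hfin.toFinset, V z with hO
  have hOo : IsOpen O := isOpen_biUnion fun z hz => hVo z (hfin.mem_toFinset.1 hz)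
  have hOQ : O ⊆ Q := iUnion₂_subset fun z _ => hVQ z
  have hdisj : Disjoint (G '' (Q \ O)) (lattice d) := by
    refine Set.disjoint_left.2 ?_
    rintro _ ⟨x, hx, rfl⟩ hxl
    exact hx.2 (mem_iUnion₂.2 ⟨x, hfin.mem_toFinset.2 ⟨hx.1, hxl⟩, hzV x ⟨hx.1, hxl⟩⟩)
  -- Away from the chosen neighbourhoods the image of `G` is a compact set missing the lattice, so
  -- only the neighbourhoods contribute.
  have hev2 := eventually_density_eq_zero ((hQc.diff hOo).image hG.continuous) hdisj
  filter_upwards [hev1, hev2] with r hr1 hr2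
  have hcont : Continuous fun x => density d r (G x) * (fderiv ℝ G x).det :=
    ((continuous_density d r).comp hG.continuous).mul
      (ContinuousLinearMap.continuous_det.comp (hG.continuous_fderiv one_ne_zero))
  rw [setIntegral_eq_of_subset_of_forall_sdiff_eq_zero hQc.measurableSet hOQ
    (fun x hx => by rw [hr2 _ ⟨x, hx, rfl⟩, zero_mul]), hO,
    integral_biUnion_finset _ (fun z hz => (hVo z (hfin.mem_toFinset.1 hz)).measurableSet)
    (fun x hx y hy hxy => (hNd (hfin.mem_toFinset.1 hx) (hfin.mem_toFinset.1 hy) hxy).mono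
      (fun _ h => h.1.2) (fun _ h => h.1.2))
    (fun z _ => (hcont.continuousOn.integrableOn_compact hQc).mono_set (hVQ z)),
    Finset.sum_congr rfl fun z hz => hr1 z (hfin.mem_toFinset.1 hz), ← Finset.mul_sum]
  congr 1
  have hp : {z ∈ Q | G z ∈ lattice d ∧ 0 < (fderiv ℝ G z).det} =
      (hfin.toFinset.filter fun z => 0 < (fderiv ℝ G z).det : Finset (ℝ × ℝ)) := by
    ext z; simp [hZ, and_assoc]
  have hn : {z ∈ Q | G z ∈ lattice d ∧ (fderiv ℝ G z).det < 0} =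
      (hfin.toFinset.filter fun z => (fderiv ℝ G z).det < 0 : Finset (ℝ × ℝ)) := by
    ext z; simp [hZ, and_assoc]
  rw [hp, hn, ncard_coe_finset, ncard_coe_finset, Finset.card_filter, Finset.card_filter]
  push_cast
  rw [← Finset.sum_sub_distrib]
  refine Finset.sum_congr rfl fun z hz => ?_
  rcases lt_or_gt_of_ne (h z (hfin.mem_toFinset.1 hz).1 (hfin.mem_toFinset.1 hz).2).2 with h0 | h0
  · simp [sign_neg h0, h0, h0.not_gt]
  · simp [sign_pos h0, h0, h0.not_gt]

theorem det_prod_eq (A : ℝ × ℝ →L[ℝ] ℝ × ℝ) :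
    A.det = (A (1, 0)).1 * (A (0, 1)).2 - (A (0, 1)).1 * (A (1, 0)).2 := by
  rw [ContinuousLinearMap.det, ← LinearMap.det_toMatrix (Module.Basis.finTwoProd ℝ),
    Matrix.det_fin_two]
  simp [LinearMap.toMatrix_apply]

/-! ### Stokes' theorem on a square -/

/-- This is the divergence theorem for the field `(ξ(∂ᵥG), -ξ(∂ᵤG))`. The terms with second
derivatives of `G` cancel by symmetry, which leaves the antisymmetrized derivative of `ξ`. -/
theorem stokes_square {E : Type*} [NormedAddCommGroup E] [NormedSpace ℝ E]
    {ξ : E → E →L[ℝ] ℝ} (hξ : ContDiff ℝ 1 ξ) {G : ℝ × ℝ → E} (hG : ContDiff ℝ 2 G) :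
    ∫ z in Icc (0 : ℝ × ℝ) 1, (fderiv ℝ ξ (G z) (fderiv ℝ G z (1, 0)) (fderiv ℝ G z (0, 1)) -
        fderiv ℝ ξ (G z) (fderiv ℝ G z (0, 1)) (fderiv ℝ G z (1, 0))) =
      (∫ v in (0 : ℝ)..1, ξ (G (1, v)) (fderiv ℝ G (1, v) (0, 1))) -
      (∫ v in (0 : ℝ)..1, ξ (G (0, v)) (fderiv ℝ G (0, v) (0, 1))) -
      (∫ u in (0 : ℝ)..1, ξ (G (u, 1)) (fderiv ℝ G (u, 1) (1, 0))) +
      ∫ u in (0 : ℝ)..1, ξ (G (u, 0)) (fderiv ℝ G (u, 0) (1, 0)) := by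
  have hdG : ContDiff ℝ 1 (fderiv ℝ G) := hG.fderiv_right (by norm_num)
  have hG1 : ContDiff ℝ 1 G := hG.of_le (by norm_num)
  have hP : ∀ e : ℝ × ℝ, ContDiff ℝ 1 fun z => ξ (G z) (fderiv ℝ G z e) := fun e =>
    (hξ.comp hG1).clm_apply (hdG.clm_apply contDiff_const)
  have hd : ∀ (e e' z : ℝ × ℝ), fderiv ℝ (fun z => ξ (G z) (fderiv ℝ G z e)) z e' =
      fderiv ℝ ξ (G z) (fderiv ℝ G z e') (fderiv ℝ G z e) +
        ξ (G z) (fderiv ℝ (fderiv ℝ G) z e' e) := by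
    intro e e' z
    have h1 : HasFDerivAt (fun z => ξ (G z)) ((fderiv ℝ ξ (G z)).comp (fderiv ℝ G z)) z :=
      ((hξ.differentiable one_ne_zero) (G z)).hasFDerivAt.comp z
        ((hG1.differentiable one_ne_zero) z).hasFDerivAt
    have h2 : HasFDerivAt (fun z => fderiv ℝ G z e) ((fderiv ℝ (fderiv ℝ G) z).flip e) z := by
      have := ((hdG.differentiable one_ne_zero) z).hasFDerivAt.clm_apply (hasFDerivAt_const e z)
      rwa [ContinuousLinearMap.comp_zero, zero_add] at this
    rw [(h1.clm_apply h2).fderiv]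
    simp [add_comm]
  have hsymm : ∀ z : ℝ × ℝ, fderiv ℝ (fderiv ℝ G) z (1, 0) (0, 1) =
      fderiv ℝ (fderiv ℝ G) z (0, 1) (1, 0) := fun z =>
    (hG.contDiffAt.isSymmSndFDerivAt (by simp)).eq _ _
  have key := integral_divergence_prod_Icc_of_hasFDerivAt_of_le
    (fun z => ξ (G z) (fderiv ℝ G z (0, 1))) (fun z => -ξ (G z) (fderiv ℝ G z (1, 0)))
    (fderiv ℝ fun z => ξ (G z) (fderiv ℝ G z (0, 1)))
    (fun z => -fderiv ℝ (fun z => ξ (G z) (fderiv ℝ G z (1, 0))) z) 0 1 (by simp)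
    (hP _).continuous.continuousOn (hP _).continuous.neg.continuousOn
    (fun z _ => ((hP _).differentiable one_ne_zero z).hasFDerivAt)
    (fun z _ => ((hP _).differentiable one_ne_zero z).hasFDerivAt.neg)
    (Continuous.integrableOn_Icc
      ((((hP _).continuous_fderiv one_ne_zero).clm_apply continuous_const).add
      (((hP _).continuous_fderiv one_ne_zero).neg.clm_apply continuous_const)))
  simp only [neg_apply, hd, hsymm, intervalIntegral.integral_neg,
    Prod.fst_zero, Prod.snd_zero, Prod.fst_one, Prod.snd_one] at key
  have hcongr : ∀ z : ℝ × ℝ,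
      fderiv ℝ ξ (G z) (fderiv ℝ G z (1, 0)) (fderiv ℝ G z (0, 1)) -
        fderiv ℝ ξ (G z) (fderiv ℝ G z (0, 1)) (fderiv ℝ G z (1, 0)) =
      fderiv ℝ ξ (G z) (fderiv ℝ G z (1, 0)) (fderiv ℝ G z (0, 1)) +
          ξ (G z) (fderiv ℝ (fderiv ℝ G) z (0, 1) (1, 0)) +
        -(fderiv ℝ ξ (G z) (fderiv ℝ G z (0, 1)) (fderiv ℝ G z (1, 0)) +
          ξ (G z) (fderiv ℝ (fderiv ℝ G) z (0, 1) (1, 0))) := fun z => by ring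
  simp only [hcongr]
  rw [key]
  ring

end SolLinking

end

/-! ### Existence of caps: affine chains modulo boundaries, and generic base points -/

noncomputable section

namespace SolLinking

/-! ### The symplectic form on the plane -/

/-- The symplectic form on `ℝ²`. -/
def symp (x y : Fin 2 → ℝ) : ℝ := x 0 * y 1 - x 1 * y 0

theorem symp_intVec (v w : Fin 2 → ℤ) : ∃ k : ℤ, symp (intVec v) (intVec w) = k :=
  ⟨v 0 * w 1 - v 1 * w 0, by simp [symp, intVec]⟩

theorem det_eq_one (g : SL(2, ℤ)) : (g.1 0 0 : ℝ) * g.1 1 1 - g.1 0 1 * g.1 1 0 = 1 := by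
  have := g.2
  rw [Matrix.det_fin_two] at this
  exact_mod_cast this

theorem symp_linMap (g : SL(2, ℤ)) (x y : Fin 2 → ℝ) :
    symp (linMap g x) (linMap g y) = symp x y := by
  simp only [symp, linMap_apply]
  linear_combination (x 0 * y 1 - x 1 * y 0) * det_eq_one g

theorem frameDet_eq (u v w : ℝ × (Fin 2 → ℝ)) :
    frameDet u v w = u.1 * symp v.2 w.2 - v.1 * symp u.2 w.2 + w.1 * symp u.2 v.2 := by
  simp only [frameDet, symp, Matrix.det_fin_three, Matrix.of_apply, Matrix.cons_val]
  ring

theorem fderiv_geodesicLift (s : ℝ) (p : Fin 2 → ℝ) (v : Fin 2 → ℤ) (t e : Fin 2 → ℝ) :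
    fderiv ℝ (geodesicLift s p v) t e = (0, e 1 • intVec v) := by
  have h : HasFDerivAt (geodesicLift s p v) ((0 : (Fin 2 → ℝ) →L[ℝ] ℝ).prod
      ((ContinuousLinearMap.proj (R := ℝ) (φ := fun _ : Fin 2 => ℝ) 1).smulRight (intVec v))) t := by
    refine (hasFDerivAt_const s t).prodMk (HasFDerivAt.const_add p ?_)
    exact ((ContinuousLinearMap.proj (R := ℝ) (φ := fun _ : Fin 2 => ℝ) 1).smulRight
      (intVec v)).hasFDerivAt
  rw [h.fderiv]
  rfl

/-! ### Affine simplices -/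

/-- The linear extension of the affine simplex with given vertices. -/
def affLift {k : ℕ} (P : Fin (k + 1) → ℝ × (Fin 2 → ℝ)) :
    (Fin (k + 1) → ℝ) →L[ℝ] ℝ × (Fin 2 → ℝ) :=
  ∑ i, (ContinuousLinearMap.proj (R := ℝ) (φ := fun _ : Fin (k + 1) => ℝ) i).smulRight (P i)

theorem affLift_apply {k : ℕ} (P : Fin (k + 1) → ℝ × (Fin 2 → ℝ)) (x : Fin (k + 1) → ℝ) :
    affLift P x = ∑ i, x i • P i := by
  simp [affLift]

/-- The affine simplex with given vertices, projected to `M`. -/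
def affSimplex (f : SL(2, ℤ)) {k : ℕ} (P : Fin (k + 1) → ℝ × (Fin 2 → ℝ)) :
    Simplex k (SolManifold f) where
  toFun x := univCover f (affLift P x.1)
  continuous_toFun := (continuous_univCover f).comp
    ((affLift P).continuous.comp continuous_subtype_val)

theorem isSmoothLift_affSimplex (f : SL(2, ℤ)) {k : ℕ} (P : Fin (k + 1) → ℝ × (Fin 2 → ℝ)) :
    IsSmoothLift (affSimplex f P) (affLift P) :=
  ⟨(affLift P).contDiff, fun _ => rfl⟩

theorem face_affSimplex (f : SL(2, ℤ)) {k : ℕ} (P : Fin (k + 2) → ℝ × (Fin 2 → ℝ))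
    (i : Fin (k + 2)) : face i (affSimplex f P) = affSimplex f (P ∘ i.succAbove) := by
  ext x
  change univCover f (affLift P (FunOnFinite.linearMap ℝ ℝ i.succAbove x)) =
    univCover f (affLift (P ∘ i.succAbove) x)
  congr 1
  rw [affLift_apply, affLift_apply, Fin.sum_univ_succAbove _ i]
  simp only [FunOnFinite.linearMap_apply_apply, Function.comp]
  have h1 : (Finset.univ.filter fun j => i.succAbove j = i) = ∅ := by
    simp [Fin.succAbove_ne]
  have h2 : ∀ j, (Finset.univ.filter fun l => i.succAbove l = i.succAbove j) = {j} := fun j => by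
    ext l; simp
  simp only [h1, h2, Finset.sum_empty, zero_smul, zero_add, Finset.sum_singleton]

theorem affSimplex_deck (f : SL(2, ℤ)) {k : ℕ} (n : ℤ) (P : Fin (k + 1) → ℝ × (Fin 2 → ℝ)) :
    affSimplex f (fun i => deck f n (P i)) = affSimplex f P := by
  ext x
  change univCover f (affLift _ x.1) = univCover f (affLift P x.1)
  rw [← univCover_deck f n (affLift P x.1)]
  congr 1
  have hx : ∑ i, x.1 i = 1 := x.2.2
  simp only [affLift_apply, deck]
  refine Prod.ext ?_ ?_
  · simp [Prod.fst_sum, mul_add, Finset.sum_add_distrib, ← Finset.sum_mul, hx]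
  · simp [Prod.snd_sum, map_sum]

theorem affSimplex_add_intVec (f : SL(2, ℤ)) {k : ℕ} (v : Fin 2 → ℤ)
    (P : Fin (k + 1) → ℝ × (Fin 2 → ℝ)) :
    affSimplex f (fun i => P i + (0, intVec v)) = affSimplex f P := by
  ext x
  change univCover f (affLift _ x.1) = univCover f (affLift P x.1)
  rw [← univCover_add_intVec f (affLift P x.1) v]
  congr 1
  have hx : ∑ i, x.1 i = 1 := x.2.2
  simp only [affLift_apply, smul_add, Finset.sum_add_distrib, ← Finset.sum_smul, hx, one_smul]

theorem geodesic_eq_affSimplex (f : SL(2, ℤ)) (s : ℝ) (p : Fin 2 → ℝ) (v : Fin 2 → ℤ) :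
    geodesic f s (toTorus p) v = affSimplex f ![(s, p), (s, p + intVec v)] := by
  ext x
  rw [← (isSmoothLift_geodesicLift f s p v).2 x]
  change _ = univCover f (affLift _ x.1)
  congr 1
  have hx : x.1 0 + x.1 1 = 1 := by rw [← Fin.sum_univ_two]; exact x.2.2
  rw [affLift_apply, Fin.sum_univ_two, geodesicLift]
  refine Prod.ext ?_ (funext fun i => ?_)
  · simp only [Matrix.cons_val_zero, Matrix.cons_val_one, Prod.fst_add, Prod.smul_fst, smul_eq_mul]
    rw [← add_mul, hx, one_mul]
  · simp only [Matrix.cons_val_zero, Matrix.cons_val_one, Prod.snd_add, Prod.smul_snd,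
      Pi.add_apply, Pi.smul_apply, smul_eq_mul]
    linear_combination (-p i) * hx

/-! ### Boundaries of chains in general position -/

/-- The `1`-chains which bound a smooth chain in general position to `β`. -/
def capBoundaries {f : SL(2, ℤ)} (β : Chain 1 (SolManifold f)) :
    Submodule ℚ (Chain 1 (SolManifold f)) :=
  (Finsupp.supported ℚ ℚ {σ | (∃ L, IsSmoothLift σ L) ∧
    GeneralPosition (Finsupp.single σ 1) β}).map (boundary 1)

theorem exists_cap_of_mem {f : SL(2, ℤ)} {α β : Chain 1 (SolManifold f)}
    (h : α ∈ capBoundaries β) : ∃ A, IsSmooth A ∧ boundary 1 A = α ∧ GeneralPosition A β := by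
  obtain ⟨A, hA, rfl⟩ := h
  rw [SetLike.mem_coe, Finsupp.mem_supported] at hA
  refine ⟨A, fun σ hσ => (hA hσ).1, rfl, fun σ hσ => (hA hσ).2 σ ?_⟩
  simp

/-- The class of an affine segment modulo boundaries. -/
def segClass {f : SL(2, ℤ)} (β : Chain 1 (SolManifold f)) (P Q : ℝ × (Fin 2 → ℝ)) :
    Chain 1 (SolManifold f) ⧸ capBoundaries β :=
  (capBoundaries β).mkQ (Finsupp.single (affSimplex f ![P, Q]) 1)

theorem segClass_deck {f : SL(2, ℤ)} (β : Chain 1 (SolManifold f)) (P Q : ℝ × (Fin 2 → ℝ)) (n : ℤ) :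
    segClass β (deck f n P) (deck f n Q) = segClass β P Q := by
  rw [segClass, segClass, ← affSimplex_deck f n ![P, Q]]
  congr 4

theorem segClass_add_intVec {f : SL(2, ℤ)} (β : Chain 1 (SolManifold f)) (P Q : ℝ × (Fin 2 → ℝ))
    (v : Fin 2 → ℤ) : segClass β (P + (0, intVec v)) (Q + (0, intVec v)) = segClass β P Q := by
  rw [segClass, segClass, ← affSimplex_add_intVec f v ![P, Q]]
  congr 4

/-- The boundary of the triangle is `QR - PR + PQ`, and it dies in the quotient. -/
theorem segClass_add_segClass {f : SL(2, ℤ)} {β : Chain 1 (SolManifold f)}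
    {P Q R : ℝ × (Fin 2 → ℝ)}
    (h : GeneralPosition (Finsupp.single (affSimplex f ![P, Q, R]) 1) β) :
    segClass β P Q + segClass β Q R = segClass β P R := by
  have hmem : Finsupp.single (affSimplex f ![Q, R]) (1 : ℚ) -
      Finsupp.single (affSimplex f ![P, R]) 1 + Finsupp.single (affSimplex f ![P, Q]) 1 ∈
      capBoundaries β := by
    refine ⟨Finsupp.single (affSimplex f ![P, Q, R]) 1,
      Finsupp.single_mem_supported ℚ 1 ⟨⟨_, isSmoothLift_affSimplex f _⟩, h⟩, ?_⟩
    have h0 : ![P, Q, R] ∘ Fin.succ = ![Q, R] := by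
      funext i; fin_cases i <;> rfl
    have h1 : ![P, Q, R] ∘ Fin.succAbove (1 : Fin 3) = ![P, R] := by
      funext i; fin_cases i <;> rfl
    have h2 : ![P, Q, R] ∘ Fin.succAbove (2 : Fin 3) = ![P, Q] := by
      funext i; fin_cases i <;> rfl
    simp [boundary, Fin.sum_univ_three, face_affSimplex, h0, h1, h2, sub_eq_add_neg]
  have := (Submodule.Quotient.mk_eq_zero (capBoundaries β)).2 hmem
  rw [Submodule.Quotient.mk_add, Submodule.Quotient.mk_sub] at this
  simp only [segClass, Submodule.mkQ_apply]
  rw [← sub_eq_zero, ← this]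
  abel

theorem affLift_triple (P Q R : ℝ × (Fin 2 → ℝ)) (x : Fin 3 → ℝ) :
    affLift ![P, Q, R] x = x 0 • P + x 1 • Q + x 2 • R := by
  rw [affLift_apply, Fin.sum_univ_three]
  rfl

/-- A triangle in a fiber is disjoint from a geodesic in another fiber. -/
theorem generalPosition_fiber (f : SL(2, ℤ)) {s ε : ℝ} (h0 : 0 < ε) (h1 : ε < 1)
    (q : Fin 2 → ℝ) (b : Fin 2 → ℤ) (P Q R : Fin 2 → ℝ) :
    GeneralPosition (Finsupp.single (affSimplex f ![(s, P), (s, Q), (s, R)]) 1)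
      (geodesicCycle f (s + ε) (toTorus q) b) := by
  intro σ hσ τ hτ x t hxt
  have hσ' : σ = affSimplex f ![(s, P), (s, Q), (s, R)] := by
    simpa using Finsupp.support_single_subset hσ
  have hτ' : τ = geodesic f (s + ε) (toTorus q) b := by
    simpa using Finsupp.support_single_subset hτ
  subst hσ' hτ'
  rw [← (isSmoothLift_affSimplex f _).2 x, ← (isSmoothLift_geodesicLift f (s + ε) q b).2 t,
    univCover_eq_iff] at hxt
  obtain ⟨n, v, h⟩ := hxt
  have hx : x.1 0 + x.1 1 + x.1 2 = 1 := by rw [← Fin.sum_univ_three]; exact x.2.2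
  have h2 := congrArg Prod.fst h
  simp only [geodesicLift, deck, affLift_triple, Prod.fst_add, Prod.smul_fst, smul_eq_mul,
    ← add_mul, hx, one_mul, add_zero] at h2
  have h3 : ε = n := by linarith
  rw [h3] at h0 h1
  have h0' : 0 < n := by exact_mod_cast h0
  have h1' : n < 1 := by exact_mod_cast h1
  -- The two fibers could meet only if `ε` were an integer.
  omega

/-- The class of a closed geodesic in the fiber over `s` is additive in its homology class. -/
theorem exists_fiberClass (f : SL(2, ℤ)) {s ε : ℝ} (h0 : 0 < ε) (h1 : ε < 1)
    (q : Fin 2 → ℝ) (b : Fin 2 → ℤ) :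
    ∃ Φ : (Fin 2 → ℤ) →+ Chain 1 (SolManifold f) ⧸
        capBoundaries (geodesicCycle f (s + ε) (toTorus q) b),
      ∀ P v, Φ v = segClass _ (s, P) (s, P + intVec v) := by
  set β := geodesicCycle f (s + ε) (toTorus q) b
  have htri : ∀ P Q R : Fin 2 → ℝ, segClass β (s, P) (s, Q) + segClass β (s, Q) (s, R) =
      segClass β (s, P) (s, R) := fun P Q R =>
    segClass_add_segClass (generalPosition_fiber f h0 h1 q b P Q R)
  have htr : ∀ (P Q : Fin 2 → ℝ) (v : Fin 2 → ℤ),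
      segClass β (s, P + intVec v) (s, Q + intVec v) = segClass β (s, P) (s, Q) := fun P Q v => by
    rw [← segClass_add_intVec β (s, P) (s, Q) v]
    simp
  have hadd : ∀ (P : Fin 2 → ℝ) (v w : Fin 2 → ℤ), segClass β (s, P) (s, P + intVec (v + w)) =
      segClass β (s, P) (s, P + intVec v) + segClass β (s, P) (s, P + intVec w) := fun P v w => by
    rw [← htri P (P + intVec v), ← htr P (P + intVec w) v, intVec_add]
    congr 3
    abel
  -- The parallelogram `P, P', P' + v, P + v` is cut along a diagonal; its sides `PP'` and `(P +
  -- v)(P' + v)` project to the same simplex of `M`.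
  have hindep : ∀ (P P' : Fin 2 → ℝ) (v : Fin 2 → ℤ), segClass β (s, P) (s, P + intVec v) =
      segClass β (s, P') (s, P' + intVec v) := fun P P' v => by
    have h1 := htri P P' (P' + intVec v)
    have h2 := htri P (P + intVec v) (P' + intVec v)
    rw [htr] at h2
    rw [← h2, add_comm] at h1
    exact (add_right_cancel h1).symm
  exact ⟨AddMonoidHom.mk' (fun v => segClass β (s, 0) (s, 0 + intVec v)) (hadd 0),
    fun P v => hindep 0 P v⟩

/-! ### The annulus swept out by a closed geodesic -/

/-- `P` is generic: `P`, `P + ε x` and the line through `P` in the direction `x` avoid all the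
translates of the lines and points relevant for the geodesic through `q` in the direction `b`. -/
structure IsGeneric (ε : ℝ) (x b : Fin 2 → ℤ) (y : Fin 2 → ℝ) : Prop where
  symp_left : ∀ k : ℤ, symp y (intVec x) ≠ k
  symp_right : b ≠ 0 → ∀ k : ℤ, symp y (intVec b) ≠ k
  symp_shift : b ≠ 0 → ∀ k : ℤ, symp (y + ε • intVec x) (intVec b) ≠ k

/-- On the line of points `τ (1, N)` each forbidden equation excludes a single `τ`, provided that
`(1, N)` is parallel neither to `x` nor to a nonzero `b`. So only countably many `τ` are bad. -/
-- The slope `N` exceeds `|x 1|` and `|b 1|`: an integral vector `z` with `z 1 = N * z 0` and `|z 1|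
-- < N` must be zero.
theorem exists_isGeneric (ε : ℝ) {x : Fin 2 → ℤ} (hx : x ≠ 0) (b : Fin 2 → ℤ) :
    ∃ y, IsGeneric ε x b y := by
  set N : ℤ := |x 1| + |b 1| + 1 with hN
  have hm : ∀ z : Fin 2 → ℤ, z ≠ 0 → |z 1| < N → (z 1 - N * z 0 : ℝ) ≠ 0 := by
    intro z hz hzN h
    have h' : z 1 = N * z 0 := by exact_mod_cast sub_eq_zero.1 h
    by_cases h0 : z 0 = 0
    · refine hz (funext fun i => ?_)
      fin_cases i
      · exact h0
      · simpa [h0] using h'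
    · have h1 : 1 ≤ |z 0| := Int.one_le_abs h0
      have h2 : 0 ≤ N := by positivity
      rw [h', abs_mul, abs_of_nonneg h2] at hzN
      nlinarith
  have hfin : ∀ (A B : ℝ) (_ : A ≠ 0) (k : ℤ), {τ : ℝ | τ * A + B = k}.Countable :=
    fun A B hA k => by
      refine Set.Countable.mono (s₂ := {(k - B) / A}) (fun τ hτ => ?_) (Set.countable_singleton _)
      have : τ * A + B = k := hτ
      rw [Set.mem_singleton_iff, eq_div_iff hA, ← this]
      ring
  have hA := hm x hx (by rw [hN]; linarith [abs_nonneg (b 1)])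
  have hsx : ∀ (τ : ℝ) (z : Fin 2 → ℤ), symp ![τ, τ * N] (intVec z) = τ * (z 1 - N * z 0) :=
    fun τ z => by
      simp only [symp, intVec, Matrix.cons_val_zero, Matrix.cons_val_one]
      ring
  have hsy : ∀ (τ : ℝ), symp (![τ, τ * N] + ε • intVec x) (intVec b) =
      τ * (b 1 - N * b 0) + ε * symp (intVec x) (intVec b) := fun τ => by
    simp only [symp, intVec, Matrix.cons_val_zero, Matrix.cons_val_one, Pi.add_apply, Pi.smul_apply,
      smul_eq_mul]
    ring
  have hc : ((⋃ k : ℤ, {τ : ℝ | τ * (x 1 - N * x 0 : ℝ) + 0 = k}) ∪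
      ⋃ k : ℤ, {τ : ℝ | b ≠ 0 ∧ (τ * (b 1 - N * b 0 : ℝ) + 0 = k ∨
        τ * (b 1 - N * b 0 : ℝ) + ε * symp (intVec x) (intVec b) = k)}).Countable := by
    refine (Set.countable_iUnion fun k => hfin _ _ hA k).union (Set.countable_iUnion fun k => ?_)
    by_cases hb : b = 0
    · simp [hb]
    · have hB := hm b hb (by rw [hN]; linarith [abs_nonneg (x 1)])
      exact ((hfin _ 0 hB k).union (hfin _ (ε * symp (intVec x) (intVec b)) hB k)).mono
        fun τ hτ => hτ.2
  obtain ⟨τ, hτ⟩ : ∃ τ, τ ∉ ((⋃ k : ℤ, {τ : ℝ | τ * (x 1 - N * x 0 : ℝ) + 0 = k}) ∪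
      ⋃ k : ℤ, {τ : ℝ | b ≠ 0 ∧ (τ * (b 1 - N * b 0 : ℝ) + 0 = k ∨
        τ * (b 1 - N * b 0 : ℝ) + ε * symp (intVec x) (intVec b) = k)}) := by
    by_contra! hall
    exact Set.not_countable_univ (α := ℝ) (hc.mono fun τ _ => hall τ)
  simp only [Set.mem_union, Set.mem_iUnion, Set.mem_ofPred_eq, not_or, not_exists, not_and,
    add_zero] at hτ
  exact ⟨![τ, τ * N], fun k => by rw [hsx]; exact hτ.1 k,
    fun hb k => by rw [hsx]; exact (hτ.2 k hb).1, fun hb k => by rw [hsy]; exact (hτ.2 k hb).2⟩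

/-- Pairing the crossing equation with `x` isolates `t`, and pairing it with `b` isolates `μ`; each
excluded value would make one of the generic pairings an integer. The values `0, 1` of `μ` are the
sides of the annulus, and `ε` is the diagonal at level `s + ε`. -/
theorem IsGeneric.of_crossing {ε : ℝ} {x b v : Fin 2 → ℤ} {y : Fin 2 → ℝ} (hy : IsGeneric ε x b y)
    {t μ : ℝ} (h : y + μ • intVec x = t • intVec b + intVec v) :
    symp (intVec x) (intVec b) ≠ 0 ∧ t ≠ 0 ∧ t ≠ 1 ∧ μ ≠ 0 ∧ μ ≠ 1 ∧ μ ≠ ε := by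
  have e0 := congrFun h 0
  have e1 := congrFun h 1
  simp only [Pi.add_apply, Pi.smul_apply, smul_eq_mul] at e0 e1
  have hl : symp y (intVec x) = t * symp (intVec b) (intVec x) + symp (intVec v) (intVec x) := by
    simp only [symp]
    linear_combination intVec x 1 * e0 - intVec x 0 * e1
  have hr : symp y (intVec b) = symp (intVec v) (intVec b) - μ * symp (intVec x) (intVec b) := by
    simp only [symp]
    linear_combination intVec b 1 * e0 - intVec b 0 * e1
  have hs : symp (y + ε • intVec x) (intVec b) =
      symp (intVec v) (intVec b) - (μ - ε) * symp (intVec x) (intVec b) := by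
    have : symp (y + ε • intVec x) (intVec b) =
        symp y (intVec b) + ε * symp (intVec x) (intVec b) := by
      simp only [symp, Pi.add_apply, Pi.smul_apply, smul_eq_mul]; ring
    rw [this, hr]; ring
  have hswap : symp (intVec b) (intVec x) = -symp (intVec x) (intVec b) := by
    simp only [symp]; ring
  obtain ⟨k1, hk1⟩ := symp_intVec v x
  obtain ⟨k2, hk2⟩ := symp_intVec v b
  obtain ⟨k3, hk3⟩ := symp_intVec x b
  rw [hswap] at hl
  have hne : symp (intVec x) (intVec b) ≠ 0 := fun h0 =>
    hy.symp_left k1 (by rw [hl, h0, hk1]; ring)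
  have hb : b ≠ 0 := by
    rintro rfl
    exact hne (by simp [symp, intVec])
  refine ⟨hne, ?_, ?_, ?_, ?_, ?_⟩ <;> rintro rfl
  · exact hy.symp_left k1 (by rw [hl, hk1]; ring)
  · exact hy.symp_left (k1 - k3) (by rw [hl, hk1, hk3]; push_cast; ring)
  · exact hy.symp_right hb k2 (by rw [hr, hk2]; ring)
  · exact hy.symp_right hb (k2 - k3) (by rw [hr, hk2, hk3]; push_cast; ring)
  · exact hy.symp_shift hb k2 (by rw [hs, hk2]; ring)

/-- A triangle between the fibers over `s` and `s + 1` is in general position to a geodesic in an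
intermediate fiber if each crossing on the level of lifts is interior and transversal. -/
theorem generalPosition_of_lift (f : SL(2, ℤ)) {s ε : ℝ} (h0 : 0 < ε) (h1 : ε < 1)
    (q : Fin 2 → ℝ) (b : Fin 2 → ℤ) (P : Fin 3 → ℝ × (Fin 2 → ℝ))
    (hP : ∀ x ∈ stdSimplex ℝ (Fin 3), (affLift P x).1 ∈ Set.Icc s (s + 1))
    (h : ∀ x ∈ stdSimplex ℝ (Fin 3), ∀ (t : ℝ) (v : Fin 2 → ℤ), (affLift P x).1 = s + ε →
      (affLift P x).2 = q + t • intVec b + intVec v → (∀ i, 0 < x i) ∧ t ≠ 0 ∧ t ≠ 1 ∧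
        frameDet (affLift P (edge 1)) (affLift P (edge 2)) (0, intVec b) ≠ 0) :
    GeneralPosition (Finsupp.single (affSimplex f P) 1)
      (geodesicCycle f (s + ε) (toTorus q) b) := by
  intro σ hσ τ hτ x t hxt
  have hσ' : σ = affSimplex f P := by
    simpa using Finsupp.support_single_subset hσ
  have hτ' : τ = geodesic f (s + ε) (toTorus q) b := by
    simpa using Finsupp.support_single_subset hτ
  subst hσ' hτ'
  have hL := isSmoothLift_geodesicLift f (s + ε) q b
  have hK := isSmoothLift_affSimplex f P
  rw [← hK.2 x, ← hL.2 t, eq_comm, univCover_eq_iff] at hxt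
  obtain ⟨n, v, hn⟩ := hxt
  have hs := hP x.1 x.2
  -- The triangle spans levels `s` to `s + 1`, and `s + ε + n` lies between them only for `n = 0`.
  have hn0 : n = 0 := by
    rw [hn] at hs
    simp only [geodesicLift, deck, Prod.fst_add, add_zero] at hs
    have h3 : (n : ℝ) < 1 := by linarith [hs.2]
    have h4 : (-1 : ℝ) < n := by linarith [hs.1]
    have h3' : n < 1 := by exact_mod_cast h3
    have h4' : -1 < n := by exact_mod_cast h4
    omega
  subst hn0
  rw [deck_zero] at hn
  obtain ⟨hx, ht0, ht1, hdet⟩ := h x.1 x.2 (t.1 1) v (by rw [hn]; simp [geodesicLift])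
    (by rw [hn]; simp [geodesicLift])
  have ht : t.1 0 + t.1 1 = 1 := by rw [← Fin.sum_univ_two]; exact t.2.2
  have hpos0 : 0 ≤ t.1 0 := t.2.1 0
  have hpos1 : 0 ≤ t.1 1 := t.2.1 1
  refine ⟨hx, fun i => ?_, ?_⟩
  · fin_cases i
    · exact lt_of_le_of_ne hpos0 fun h => ht1 (by have h' : 0 = t.1 0 := h; linarith)
    · exact lt_of_le_of_ne hpos1 (Ne.symm ht0)
  · have hL' := hL.deck_add 0 v
    simp only [deck_zero] at hL'
    have hcd : crossingDet (affLift P) (fun y => geodesicLift (s + ε) q b y + (0, intVec v)) x.1 t.1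
        = frameDet (affLift P (edge 1)) (affLift P (edge 2)) (0, intVec b) := by
      rw [crossingDet, fderiv_add_const, fderiv_geodesicLift, ContinuousLinearMap.fderiv]
      simp [edge]
    rcases lt_or_gt_of_ne hdet with hd | hd
    · exact Or.inr ⟨_, _, hK, hL', hn, by rwa [hcd]⟩
    · exact Or.inl ⟨_, _, hK, hL', hn, by rwa [hcd]⟩

end SolLinking

end

/-! ### Existence of caps: the annulus relation and its rational consequence -/

noncomputable section

namespace SolLinking

theorem frameDet_affLift_edges (P Q R : ℝ × (Fin 2 → ℝ)) (w : Fin 2 → ℝ) :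
    frameDet (affLift ![P, Q, R] (edge 1)) (affLift ![P, Q, R] (edge 2)) (0, w) =
      (Q.1 - P.1) * symp (R.2 - P.2) w - (R.1 - P.1) * symp (Q.2 - P.2) w := by
  have h1 : affLift ![P, Q, R] (edge 1) = Q - P := by
    simp [affLift_triple, edge, sub_eq_add_neg, add_comm]
  have h2 : affLift ![P, Q, R] (edge 2) = R - P := by
    simp [affLift_triple, edge, sub_eq_add_neg, add_comm]
  rw [h1, h2, frameDet_eq]
  simp

/-- At level `s + ε` this half of the annulus is the segment of points `q + y + μ x` with `ε ≤ μ ≤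
1`. Genericity keeps crossings away from its two ends. -/
theorem IsGeneric.generalPosition_lower (f : SL(2, ℤ)) {s ε : ℝ} (h0 : 0 < ε) (h1 : ε < 1)
    (q : Fin 2 → ℝ) {x b : Fin 2 → ℤ} {y : Fin 2 → ℝ} (hy : IsGeneric ε x b y) :
    GeneralPosition (Finsupp.single (affSimplex f
      ![(s, q + y), (s, q + y + intVec x), (s + 1, q + y + intVec x)]) 1)
      (geodesicCycle f (s + ε) (toTorus q) b) := by
  have hcoord : ∀ z ∈ stdSimplex ℝ (Fin 3), affLift
      ![(s, q + y), (s, q + y + intVec x), (s + 1, q + y + intVec x)] z =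
        (s + z 2, q + y + (z 1 + z 2) • intVec x) := fun z hz => by
    have hs : z 0 + z 1 + z 2 = 1 := by rw [← Fin.sum_univ_three]; exact hz.2
    have : z 0 = 1 - z 1 - z 2 := by linarith
    rw [affLift_triple, this]
    refine Prod.ext ?_ (funext fun i => ?_)
    · simp only [Prod.fst_add, Prod.smul_fst, smul_eq_mul]; ring
    · simp only [Prod.snd_add, Prod.smul_snd, smul_eq_mul, Pi.add_apply, Pi.smul_apply]; ring
  refine generalPosition_of_lift f h0 h1 q b _ (fun z hz => ?_) fun z hz t v hzs hzw => ?_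
  · rw [hcoord z hz]
    exact ⟨by linarith [hz.1 2], by linarith [(mem_Icc_of_mem_stdSimplex hz 2).2]⟩
  · rw [hcoord z hz] at hzs hzw
    have h2 : z 2 = ε := by simpa using hzs
    have hs : z 0 + z 1 + z 2 = 1 := by rw [← Fin.sum_univ_three]; exact hz.2
    obtain ⟨hne, ht0, ht1, hm0, hm1, hmε⟩ := hy.of_crossing (t := t) (μ := z 1 + z 2) (v := v) (by
      have h3 : q + y + (z 1 + z 2) • intVec x = q + t • intVec b + intVec v := hzw
      rw [add_assoc, add_assoc] at h3
      exact add_left_cancel h3)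
    refine ⟨fun i => ?_, ht0, ht1, ?_⟩
    · refine lt_of_le_of_ne (hz.1 i) fun hi => ?_
      fin_cases i
      · exact hm1 (by have hi' : 0 = z 0 := hi; linarith)
      · exact hmε (by have hi' : 0 = z 1 := hi; linarith)
      · have hi' : 0 = z 2 := hi
        linarith
    · rw [frameDet_affLift_edges]
      simpa using hne

/-- The complementary half, which at level `s + ε` is the segment `0 ≤ μ ≤ ε`. -/
theorem IsGeneric.generalPosition_upper (f : SL(2, ℤ)) {s ε : ℝ} (h0 : 0 < ε) (h1 : ε < 1)
    (q : Fin 2 → ℝ) {x b : Fin 2 → ℤ} {y : Fin 2 → ℝ} (hy : IsGeneric ε x b y) :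
    GeneralPosition (Finsupp.single (affSimplex f
      ![(s, q + y), (s + 1, q + y), (s + 1, q + y + intVec x)]) 1)
      (geodesicCycle f (s + ε) (toTorus q) b) := by
  have hcoord : ∀ z ∈ stdSimplex ℝ (Fin 3), affLift
      ![(s, q + y), (s + 1, q + y), (s + 1, q + y + intVec x)] z =
        (s + (z 1 + z 2), q + y + z 2 • intVec x) := fun z hz => by
    have hs : z 0 + z 1 + z 2 = 1 := by rw [← Fin.sum_univ_three]; exact hz.2
    have : z 0 = 1 - z 1 - z 2 := by linarith
    rw [affLift_triple, this]
    refine Prod.ext ?_ (funext fun i => ?_)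
    · simp only [Prod.fst_add, Prod.smul_fst, smul_eq_mul]; ring
    · simp only [Prod.snd_add, Prod.smul_snd, smul_eq_mul, Pi.add_apply, Pi.smul_apply]; ring
  refine generalPosition_of_lift f h0 h1 q b _ (fun z hz => ?_) fun z hz t v hzs hzw => ?_
  · have hs : z 0 + z 1 + z 2 = 1 := by rw [← Fin.sum_univ_three]; exact hz.2
    rw [hcoord z hz]
    exact ⟨by linarith [hz.1 1, hz.1 2], by linarith [hz.1 0]⟩
  · rw [hcoord z hz] at hzs hzw
    have h2 : z 1 + z 2 = ε := by simpa using hzs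
    have hs : z 0 + z 1 + z 2 = 1 := by rw [← Fin.sum_univ_three]; exact hz.2
    obtain ⟨hne, ht0, ht1, hm0, hm1, hmε⟩ := hy.of_crossing (t := t) (μ := z 2) (v := v) (by
      have h3 : q + y + z 2 • intVec x = q + t • intVec b + intVec v := hzw
      rw [add_assoc, add_assoc] at h3
      exact add_left_cancel h3)
    refine ⟨fun i => ?_, ht0, ht1, ?_⟩
    · refine lt_of_le_of_ne (hz.1 i) fun hi => ?_
      fin_cases i
      · have hi' : 0 = z 0 := hi
        linarith
      · exact hmε (by have hi' : 0 = z 1 := hi; linarith)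
      · exact hm0 hi.symm
    · rw [frameDet_affLift_edges]
      simpa [symp] using hne

/-! ### Closed geodesics bound rationally -/

/-- Here hyperbolicity enters: `2 - tr f` is the determinant of `f⁻¹ - I`. The discriminant is `(tr
f)² - 4`, which would vanish. -/
theorem trace_ne_two {f : SL(2, ℤ)} (hf : (f : Matrix (Fin 2) (Fin 2) ℤ).IsHyperbolic) :
    f.1 0 0 + f.1 1 1 ≠ 2 := by
  intro h
  have h1 : 0 < (f : Matrix (Fin 2) (Fin 2) ℤ).discr := hf
  rw [Matrix.discr_fin_two, f.2, Matrix.trace_fin_two, h] at h1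
  norm_num at h1

theorem geodesicCycle_mem_capBoundaries {f : SL(2, ℤ)}
    (hf : (f : Matrix (Fin 2) (Fin 2) ℤ).IsHyperbolic) (s : ℝ) {ε : ℝ} (h0 : 0 < ε) (h1 : ε < 1)
    (p q : Torus) (a b : Fin 2 → ℤ) :
    geodesicCycle f s p a ∈ capBoundaries (geodesicCycle f (s + ε) q b) := by
  obtain ⟨p, rfl⟩ := toTorus_surjective p
  obtain ⟨q, rfl⟩ := toTorus_surjective q
  obtain ⟨Φ, hΦ⟩ := exists_fiberClass f (s := s) h0 h1 q b
  suffices hΦa : Φ a = 0 by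
    rw [hΦ p a, segClass, Submodule.mkQ_apply, Submodule.Quotient.mk_eq_zero] at hΦa
    rwa [← geodesic_eq_affSimplex] at hΦa
  -- Both halves of the annulus share the diagonal, and its two vertical sides differ by the
  -- integral translation `x`, so they cancel. The deck transformation with `n = -1` carries the
  -- upper end back to level `s`.
  have hinv : ∀ x : Fin 2 → ℤ, Φ ((f⁻¹).1.mulVec x) = Φ x := by
    intro x
    by_cases hx : x = 0
    · simp [hx]
    obtain ⟨y, hy⟩ := exists_isGeneric ε hx b
    have h2 := segClass_add_segClass (hy.generalPosition_lower f (s := s) h0 h1 q)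
    have h3 := segClass_add_segClass (hy.generalPosition_upper f (s := s) h0 h1 q)
    have h4 := segClass_add_intVec (geodesicCycle f (s + ε) (toTorus q) b) (s, q + y) (s + 1, q + y) x
    simp only [Prod.mk_add_mk, add_zero] at h4
    rw [← h3, h4] at h2
    have h5 := add_left_cancel ((add_comm _ _).trans h2)
    rw [hΦ (q + y) x, h5, ← segClass_deck _ _ _ (-1), hΦ (linMap f⁻¹ (q + y))]
    have h6 : linMap f⁻¹ (intVec x) = intVec ((f⁻¹).1.mulVec x) := by
      funext i
      simp [linMap_apply, intVec, Matrix.mulVec, dotProduct, Fin.sum_univ_two]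
    simp only [deck, zpow_neg, zpow_one, Int.cast_neg, Int.cast_one, add_neg_cancel_right,
      map_add (linMap f⁻¹), h6]
  set D : ℤ := 2 - (f.1 0 0 + f.1 1 1) with hD
  have hD0 : D ≠ 0 := sub_ne_zero.2 (Ne.symm (trace_ne_two hf))
  have hdet : f.1 0 0 * f.1 1 1 - f.1 0 1 * f.1 1 0 = 1 := by
    have := f.2
    rwa [Matrix.det_fin_two] at this
  -- This is `(f - I) a`; then `(f⁻¹ - I) x = (2 - f - f⁻¹) a = D a` by Cayley-Hamilton.
  set x : Fin 2 → ℤ := ![(f.1 0 0 - 1) * a 0 + f.1 0 1 * a 1, f.1 1 0 * a 0 + (f.1 1 1 - 1) * a 1]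
    with hx
  have hDa : (f⁻¹).1.mulVec x = x + D • a := by
    funext i
    rw [Matrix.SpecialLinearGroup.coe_inv, Matrix.adjugate_fin_two]
    fin_cases i
    · simp [Matrix.mulVec, dotProduct, Fin.sum_univ_two, hx, hD]
      linear_combination a 0 * hdet
    · simp [Matrix.mulVec, dotProduct, Fin.sum_univ_two, hx, hD]
      linear_combination a 1 * hdet
  have h6 := hinv x
  -- The relation is now `D • Φ a = 0` in a rational vector space, where `D` can be divided out.
  rw [hDa, map_add, map_zsmul, add_eq_left, ← Int.cast_smul_eq_zsmul ℚ] at h6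
  exact (smul_eq_zero.1 h6).resolve_left (by exact_mod_cast hD0)

theorem disjoint_carrier_geodesicCycle (f : SL(2, ℤ)) (s : ℝ) {ε : ℝ} (h0 : 0 < ε) (h1 : ε < 1)
    (p q : Torus) (a b : Fin 2 → ℤ) :
    Disjoint (carrier (geodesicCycle f s p a)) (carrier (geodesicCycle f (s + ε) q b)) := by
  obtain ⟨p, rfl⟩ := toTorus_surjective p
  obtain ⟨q, rfl⟩ := toTorus_surjective q
  refine Set.disjoint_left.2 fun m hm hm' => ?_
  simp only [carrier, geodesicCycle, Finsupp.support_single _ one_ne_zero, Finset.mem_singleton,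
    Set.iUnion_iUnion_eq_left, Set.mem_range] at hm hm'
  obtain ⟨t, rfl⟩ := hm
  obtain ⟨t', ht'⟩ := hm'
  rw [← (isSmoothLift_geodesicLift f _ p a).2 t, ← (isSmoothLift_geodesicLift f _ q b).2 t',
    eq_comm, univCover_eq_iff] at ht'
  obtain ⟨n, v, h⟩ := ht'
  have h2 := congrArg Prod.fst h
  simp only [geodesicLift, deck, Prod.fst_add, add_zero] at h2
  have h3 : ε = n := by linarith
  rw [h3] at h0 h1
  have h0' : 0 < n := by exact_mod_cast h0
  have h1' : n < 1 := by exact_mod_cast h1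
  omega

end SolLinking

end

/-! ### The dual 1-form and its pairing with 1-chains -/

noncomputable section

namespace SolLinking

open MeasureTheory Set Filter Topology

/-! ### A `1`-form whose differential is dual to a closed geodesic -/

/-- The covector `w ↦ ⟨w, b⟩`. -/
def sympDual (b : Fin 2 → ℤ) : (Fin 2 → ℝ) →L[ℝ] ℝ :=
  (b 1 : ℝ) • ContinuousLinearMap.proj 0 - (b 0 : ℝ) • ContinuousLinearMap.proj 1

theorem sympDual_apply (b : Fin 2 → ℤ) (w : Fin 2 → ℝ) : sympDual b w = symp w (intVec b) := by
  simp [sympDual, symp, intVec]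
  ring

/-- The differential of a deck transformation. -/
def deckLin (f : SL(2, ℤ)) (n : ℤ) :
    ℝ × (Fin 2 → ℝ) →L[ℝ] ℝ × (Fin 2 → ℝ) :=
  (ContinuousLinearMap.id ℝ ℝ).prodMap (linMap (f ^ n))

theorem hasFDerivAt_deck (f : SL(2, ℤ)) (n : ℤ) (x : ℝ × (Fin 2 → ℝ)) :
    HasFDerivAt (deck f n) (deckLin f n) x := by
  have h : deck f n = fun x => deckLin f n x + ((n : ℝ), 0) := by
    funext y
    refine Prod.ext ?_ ?_ <;> simp [deck, deckLin]
  rw [h]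
  exact (deckLin f n).hasFDerivAt.add_const _

/-- The standard parametrization of the `1`-simplex. -/
def param (t : ℝ) : Fin 2 → ℝ := ![1 - t, t]

theorem param_mem {t : ℝ} (ht : t ∈ Icc (0 : ℝ) 1) :
    param t ∈ stdSimplex ℝ (Fin 2) := by
  refine ⟨fun i => ?_, by simp [param]⟩
  fin_cases i
  · exact sub_nonneg.2 ht.2
  · exact ht.1

/-- The data of a closed geodesic in direction `b` through `(s₀, q)`, of a common divisor `d` of `b`,
and of a covector `c` with `c ∘ f⁻¹ - c = ⟨·, b⟩`. -/
structure DualData (f : SL(2, ℤ)) where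
  /-- the fiber -/
  s₀ : ℝ
  /-- the starting point -/
  q : Fin 2 → ℝ
  /-- the direction -/
  b : Fin 2 → ℤ
  /-- the divisor -/
  d : ℝ
  /-- the covector -/
  c : (Fin 2 → ℝ) →L[ℝ] ℝ
  d_pos : 0 < d
  dvd : ∀ i, ∃ k : ℤ, (b i : ℝ) = k * d
  cocycle : ∀ w, c (linMap f⁻¹ w) = c w + sympDual b w

variable {f : SL(2, ℤ)} (Ω : DualData f)

namespace DualData

/-- The coefficient of the covector `c`: a bump function on an interval of length `1`. -/
def plateau (r s : ℝ) : ℝ := step r (s - Ω.s₀ + 1) - step r (s - Ω.s₀)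

/-- The form whose sum over all translates by deck transformations is a primitive of a form
concentrated near the geodesic. -/
def form (r : ℝ) (x : ℝ × (Fin 2 → ℝ)) : ℝ × (Fin 2 → ℝ) →L[ℝ] ℝ :=
  Ω.plateau r x.1 • Ω.c.comp (ContinuousLinearMap.snd ℝ ℝ (Fin 2 → ℝ)) -
    (bump r (x.1 - Ω.s₀) * sawtooth Ω.d r (sympDual Ω.b (x.2 - Ω.q))) •
      ContinuousLinearMap.fst ℝ ℝ (Fin 2 → ℝ)

theorem form_apply (r : ℝ) (x u : ℝ × (Fin 2 → ℝ)) :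
    Ω.form r x u = Ω.plateau r x.1 * Ω.c u.2 -
      bump r (x.1 - Ω.s₀) * sawtooth Ω.d r (sympDual Ω.b (x.2 - Ω.q)) * u.1 := rfl

theorem hasDerivAt_plateau (r s : ℝ) :
    HasDerivAt (Ω.plateau r) (bump r (s - Ω.s₀ + 1) - bump r (s - Ω.s₀)) s := by
  have h1 : HasDerivAt (fun s => s - Ω.s₀) 1 s := (hasDerivAt_id s).sub_const _
  have h2 : HasDerivAt (fun s => s - Ω.s₀ + 1) 1 s := h1.add_const _
  have := ((hasDerivAt_step r _).comp s h2).sub ((hasDerivAt_step r _).comp s h1)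
  rwa [mul_one, mul_one] at this

theorem contDiff_plateau (r : ℝ) : ContDiff ℝ ∞ (Ω.plateau r) :=
  ((contDiff_step r).comp ((contDiff_id.sub contDiff_const).add contDiff_const)).sub
    ((contDiff_step r).comp (contDiff_id.sub contDiff_const))

theorem contDiff_form (r : ℝ) : ContDiff ℝ 1 (Ω.form r) := by
  have h1 : ContDiff ℝ 1 fun x : ℝ × (Fin 2 → ℝ) => Ω.plateau r x.1 :=
    ((Ω.contDiff_plateau r).of_le (by simp)).comp contDiff_fst
  have h2 : ContDiff ℝ 1 fun x : ℝ × (Fin 2 → ℝ) => bump r (x.1 - Ω.s₀) :=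
    ((contDiff_bump r).of_le (by simp)).comp (contDiff_fst.sub contDiff_const)
  have h3 : ContDiff ℝ 1 fun x : ℝ × (Fin 2 → ℝ) =>
      sawtooth Ω.d r (sympDual Ω.b (x.2 - Ω.q)) :=
    (contDiff_sawtooth Ω.d r).comp
      ((sympDual Ω.b).contDiff.comp (contDiff_snd.sub contDiff_const))
  exact (h1.smul contDiff_const).sub ((h2.mul h3).smul contDiff_const)

theorem fderiv_form (r : ℝ) (x u v : ℝ × (Fin 2 → ℝ)) :
    fderiv ℝ (Ω.form r) x u v =
      (bump r (x.1 - Ω.s₀ + 1) - bump r (x.1 - Ω.s₀)) * u.1 * Ω.c v.2 -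
      (deriv (bump r) (x.1 - Ω.s₀) * u.1 * sawtooth Ω.d r (sympDual Ω.b (x.2 - Ω.q)) +
        bump r (x.1 - Ω.s₀) * ((periodicBump Ω.d r (sympDual Ω.b (x.2 - Ω.q)) - 1) *
          sympDual Ω.b u.2)) * v.1 := by
  have hf : HasFDerivAt (fun x : ℝ × (Fin 2 → ℝ) => x.1 - Ω.s₀)
      (ContinuousLinearMap.fst ℝ ℝ (Fin 2 → ℝ)) x := hasFDerivAt_fst.sub_const _
  have hs : HasFDerivAt (fun x : ℝ × (Fin 2 → ℝ) => sympDual Ω.b (x.2 - Ω.q))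
      ((sympDual Ω.b).comp (ContinuousLinearMap.snd ℝ ℝ (Fin 2 → ℝ))) x :=
    (sympDual Ω.b).hasFDerivAt.comp x (hasFDerivAt_snd.sub_const _)
  have h1 : HasFDerivAt (fun x : ℝ × (Fin 2 → ℝ) => Ω.plateau r x.1) _ x :=
    (Ω.hasDerivAt_plateau r x.1).comp_hasFDerivAt x
      (hasFDerivAt_fst : HasFDerivAt _ (ContinuousLinearMap.fst ℝ ℝ (Fin 2 → ℝ)) x)
  have h2 : HasFDerivAt (fun x : ℝ × (Fin 2 → ℝ) => bump r (x.1 - Ω.s₀)) _ x :=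
    (((contDiff_bump r).differentiable (by simp)) _).hasDerivAt.comp_hasFDerivAt x hf
  have h3 : HasFDerivAt (fun x : ℝ × (Fin 2 → ℝ) =>
      sawtooth Ω.d r (sympDual Ω.b (x.2 - Ω.q))) _ x :=
    (hasDerivAt_sawtooth Ω.d r _).comp_hasFDerivAt x hs
  have h4 := (h1.smul_const (Ω.c.comp (ContinuousLinearMap.snd ℝ ℝ (Fin 2 → ℝ)))).sub
    ((h2.mul h3).smul_const (ContinuousLinearMap.fst ℝ ℝ (Fin 2 → ℝ)))
  have h5 : fderiv ℝ (Ω.form r) x = _ := h4.fderiv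
  rw [h5]
  change (bump r (x.1 - Ω.s₀ + 1) - bump r (x.1 - Ω.s₀)) * u.1 * Ω.c v.2 -
    (bump r (x.1 - Ω.s₀) * ((periodicBump Ω.d r (sympDual Ω.b (x.2 - Ω.q)) - 1) *
      sympDual Ω.b u.2) + sawtooth Ω.d r (sympDual Ω.b (x.2 - Ω.q)) *
      (deriv (bump r) (x.1 - Ω.s₀) * u.1)) * v.1 = _
  ring

/-- The part of the differential of `form` which cancels under summation over all deck
transformations. -/
def telescope (r : ℝ) (x u v : ℝ × (Fin 2 → ℝ)) : ℝ :=
  bump r (x.1 - Ω.s₀) * (u.1 * Ω.c (linMap f⁻¹ v.2) - v.1 * Ω.c (linMap f⁻¹ u.2))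

/-- The plateau has derivative `bump` at `s₀ - 1` minus `bump` at `s₀`. Moving the first bump to
`s₀` by a deck transformation replaces `c` by `c ∘ f⁻¹ = c + ⟨·, b⟩`, and the error `⟨·, b⟩` is
cancelled by the `-1` in the derivative of the sawtooth. What survives besides the telescoping
difference is the density times `ds ∧ ⟨dw, b⟩`, which is the determinant of a frame completed by
`(0, b)`. -/
theorem curl_form (r : ℝ) (x u v : ℝ × (Fin 2 → ℝ)) :
    fderiv ℝ (Ω.form r) x u v - fderiv ℝ (Ω.form r) x v u =
      Ω.telescope r (deck f 1 x) (deckLin f 1 u) (deckLin f 1 v) - Ω.telescope r x u v +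
      density Ω.d r (x.1 - Ω.s₀, sympDual Ω.b (x.2 - Ω.q)) *
        (u.1 * sympDual Ω.b v.2 - v.1 * sympDual Ω.b u.2) := by
  have h : ∀ w, linMap f⁻¹ (linMap f w) = w := fun w => by
    rw [← linMap_mul, inv_mul_cancel, linMap_one]
  simp only [fderiv_form, telescope, deck, deckLin, density, ContinuousLinearMap.coe_prodMap',
    zpow_one, ContinuousLinearMap.id_apply, Prod.map_fst, Prod.map_snd, h, Ω.cocycle, Int.cast_one]
  rw [show x.1 + 1 - Ω.s₀ = x.1 - Ω.s₀ + 1 by ring]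
  ring

/-- The plateau lives on `[s₀ - 1 - r, s₀ + r]`, and `r < 1` makes `2` a bound that does not depend
on `r`. -/
theorem form_eq_zero {r : ℝ} (h0 : 0 < r) (h1 : r < 1) {x : ℝ × (Fin 2 → ℝ)}
    (hx : 2 < |x.1 - Ω.s₀|) : Ω.form r x = 0 := by
  have hb : bump r (x.1 - Ω.s₀) = 0 := bump_of_lt_abs h0 (by linarith)
  have hp : Ω.plateau r x.1 = 0 := by
    rcases lt_abs.1 hx with h | h
    · rw [plateau, step_of_ge h0 (by linarith), step_of_ge h0 (by linarith), sub_self]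
    · rw [plateau, step_of_le h0 (by linarith), step_of_le h0 (by linarith), sub_self]
  rw [form, hb, hp, zero_smul, zero_mul, zero_smul, sub_zero]

theorem sympDual_intVec (v : Fin 2 → ℤ) :
    ∃ k : ℤ, sympDual Ω.b (intVec v) = k * Ω.d := by
  obtain ⟨k0, h0⟩ := Ω.dvd 0
  obtain ⟨k1, h1⟩ := Ω.dvd 1
  refine ⟨k1 * v 0 - k0 * v 1, ?_⟩
  simp only [sympDual_apply, symp, intVec, h0, h1]
  push_cast
  ring

theorem form_add_intVec {r : ℝ} (h0 : 0 < r) (x : ℝ × (Fin 2 → ℝ)) (v : Fin 2 → ℤ) :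
    Ω.form r (x + (0, intVec v)) = Ω.form r x := by
  obtain ⟨k, hk⟩ := Ω.sympDual_intVec v
  have h : sympDual Ω.b (x.2 + intVec v - Ω.q) = sympDual Ω.b (x.2 - Ω.q) + k * Ω.d := by
    rw [← hk, ← map_add]
    congr 1
    abel
  simp only [form, Prod.fst_add, Prod.snd_add, add_zero, h,
    ((periodic_sawtooth Ω.d_pos h0).int_mul k) _]

/-! ### Integration along paths -/

/-- The integral of `form` along a path. -/
def pathIntegral (r : ℝ) (γ : ℝ → ℝ × (Fin 2 → ℝ)) : ℝ :=
  ∫ t in (0 : ℝ)..1, Ω.form r (γ t) (deriv γ t)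

theorem pathIntegral_congr (r : ℝ) {γ γ' : ℝ → ℝ × (Fin 2 → ℝ)} (h : EqOn γ γ' (Icc 0 1)) :
    Ω.pathIntegral r γ = Ω.pathIntegral r γ' := by
  rw [pathIntegral, pathIntegral, intervalIntegral.integral_of_le zero_le_one,
    intervalIntegral.integral_of_le zero_le_one, integral_Ioc_eq_integral_Ioo,
    integral_Ioc_eq_integral_Ioo]
  refine setIntegral_congr_fun measurableSet_Ioo fun t ht => ?_
  have h1 : γ =ᶠ[𝓝 t] γ' := by
    filter_upwards [Ioo_mem_nhds ht.1 ht.2] with y hy using h (Ioo_subset_Icc_self hy)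
  simp only [h1.deriv_eq, h (Ioo_subset_Icc_self ht)]

theorem pathIntegral_add_intVec {r : ℝ} (h0 : 0 < r) (γ : ℝ → ℝ × (Fin 2 → ℝ)) (v : Fin 2 → ℤ) :
    Ω.pathIntegral r (fun t => γ t + (0, intVec v)) = Ω.pathIntegral r γ := by
  simp only [pathIntegral, Ω.form_add_intVec h0, deriv_add_const]

theorem pathIntegral_eq_zero {r : ℝ} (h0 : 0 < r) (h1 : r < 1) {γ : ℝ → ℝ × (Fin 2 → ℝ)}
    (hγ : ∀ t ∈ Icc (0 : ℝ) 1, 2 < |(γ t).1 - Ω.s₀|) : Ω.pathIntegral r γ = 0 := by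
  rw [pathIntegral, intervalIntegral.integral_congr (g := fun _ => 0), intervalIntegral.integral_zero]
  intro t ht
  rw [uIcc_of_le zero_le_one] at ht
  simp only [Ω.form_eq_zero h0 h1 (hγ t ht)]
  rfl

/-- The integral of the sum of all translates of `form` along a path. -/
def liftPairing (r : ℝ) (γ : ℝ → ℝ × (Fin 2 → ℝ)) : ℝ :=
  ∑ᶠ n : ℤ, Ω.pathIntegral r fun t => deck f n (γ t)

/-- Two lifts differ by some `deck f m`, which only shifts the summation index, and by an integral
translation, under which the form is invariant. -/
theorem liftPairing_eq_of_lifts {r : ℝ} (h0 : 0 < r) {τ : Simplex 1 (SolManifold f)}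
    {K L : (Fin 2 → ℝ) → ℝ × (Fin 2 → ℝ)} (hK : IsSmoothLift τ K) (hL : IsSmoothLift τ L) :
    Ω.liftPairing r (fun t => L (param t)) = Ω.liftPairing r (fun t => K (param t)) := by
  obtain ⟨m, v, h⟩ := exists_deck_of_lifts hK hL
  refine (finsum_congr fun n => ?_).trans (finsum_comp_equiv (Equiv.addRight m))
  obtain ⟨v', hv'⟩ : ∃ v' : Fin 2 → ℤ, linMap (f ^ n) (intVec v) = intVec v' :=
    ⟨(f ^ n).1.mulVec v, by
      funext i
      simp [linMap_apply, intVec, Matrix.mulVec, dotProduct, Fin.sum_univ_two]⟩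
  refine (Ω.pathIntegral_congr r fun t ht => ?_).trans (Ω.pathIntegral_add_intVec h0 _ v')
  change deck f n (L (param t)) = _
  rw [h _ (param_mem ht), Equiv.coe_addRight, ← deck_deck]
  ext
  · simp [deck]
  · simp [deck, hv']

open Classical in
/-- The integral of the sum of all translates of `form` over a smooth `1`-simplex of `M`. -/
def simplexPairing (r : ℝ) (τ : Simplex 1 (SolManifold f)) : ℝ :=
  if h : ∃ L, IsSmoothLift τ L then Ω.liftPairing r (fun t => h.choose (param t)) else 0

theorem simplexPairing_eq {r : ℝ} (h0 : 0 < r) {τ : Simplex 1 (SolManifold f)}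
    {L : (Fin 2 → ℝ) → ℝ × (Fin 2 → ℝ)} (hL : IsSmoothLift τ L) :
    Ω.simplexPairing r τ = Ω.liftPairing r (fun t => L (param t)) := by
  have h : ∃ L, IsSmoothLift τ L := ⟨L, hL⟩
  rw [simplexPairing, dif_pos h, Ω.liftPairing_eq_of_lifts h0 hL h.choose_spec]

/-- The integral over `1`-chains. -/
def chainPairing (r : ℝ) : Chain 1 (SolManifold f) →ₗ[ℚ] ℝ :=
  Finsupp.linearCombination ℚ (Ω.simplexPairing r)

end DualData

end SolLinking

end

/-! ### Stokes for the summed form over a singular 2-simplex -/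

noncomputable section

namespace SolLinking

open MeasureTheory Set Filter Topology

variable {f : SL(2, ℤ)}

/-! ### Stokes' theorem for a singular simplex -/

/-- The parametrization of the `2`-simplex by the square, collapsing an edge to a vertex. -/
def duffy (z : ℝ × ℝ) : Fin 3 → ℝ := ![1 - z.1, z.1 * (1 - z.2), z.1 * z.2]

theorem duffy_mem {z : ℝ × ℝ} (hz : z ∈ Icc (0 : ℝ × ℝ) 1) : duffy z ∈ stdSimplex ℝ (Fin 3) := by
  obtain ⟨⟨h1, h2⟩, h3, h4⟩ := hz
  simp only [Prod.fst_zero, Prod.snd_zero, Prod.fst_one, Prod.snd_one] at h1 h2 h3 h4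
  refine ⟨fun i => ?_, ?_⟩
  · fin_cases i
    · exact sub_nonneg.2 h3
    · exact mul_nonneg h1 (sub_nonneg.2 h4)
    · exact mul_nonneg h1 h2
  · rw [Fin.sum_univ_three]
    simp only [duffy, Matrix.cons_val]
    ring

theorem contDiff_duffy : ContDiff ℝ ∞ duffy := by
  refine contDiff_pi.2 fun i => ?_
  fin_cases i
  · exact contDiff_const.sub contDiff_fst
  · exact contDiff_fst.mul (contDiff_const.sub contDiff_snd)
  · exact contDiff_fst.mul contDiff_snd

theorem IsSmoothLift.face {k : ℕ} {σ : Simplex (k + 1) (SolManifold f)}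
    {K : (Fin (k + 2) → ℝ) → ℝ × (Fin 2 → ℝ)} (hK : IsSmoothLift σ K) (i : Fin (k + 2)) :
    IsSmoothLift (face i σ) fun x => K (FunOnFinite.linearMap ℝ ℝ i.succAbove x) :=
  ⟨hK.1.comp (LinearMap.toContinuousLinearMap (FunOnFinite.linearMap ℝ ℝ i.succAbove)).contDiff,
    fun x => hK.2 (stdSimplex.map i.succAbove x)⟩

theorem face_param_zero (t : ℝ) :
    FunOnFinite.linearMap ℝ ℝ (Fin.succAbove (0 : Fin 3)) (param t) = duffy (1, t) := by
  ext j
  rw [FunOnFinite.linearMap_apply_apply, Finset.sum_filter, Fin.sum_univ_two]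
  fin_cases j <;> simp [param, duffy, Fin.succAbove, Fin.ext_iff]

theorem face_param_one (t : ℝ) :
    FunOnFinite.linearMap ℝ ℝ (Fin.succAbove (1 : Fin 3)) (param t) = duffy (t, 1) := by
  ext j
  rw [FunOnFinite.linearMap_apply_apply, Finset.sum_filter, Fin.sum_univ_two]
  fin_cases j <;> simp [param, duffy, Fin.succAbove, Fin.ext_iff]

theorem face_param_two (t : ℝ) :
    FunOnFinite.linearMap ℝ ℝ (Fin.succAbove (2 : Fin 3)) (param t) = duffy (t, 0) := by
  ext j
  rw [FunOnFinite.linearMap_apply_apply, Finset.sum_filter, Fin.sum_univ_two]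
  fin_cases j <;> simp [param, duffy, Fin.succAbove, Fin.lt_def, Fin.ext_iff]

theorem fderiv_deck_comp {X : Type*} [NormedAddCommGroup X] [NormedSpace ℝ X]
    {G : X → ℝ × (Fin 2 → ℝ)} (hG : ContDiff ℝ ∞ G) (n : ℤ) (z e : X) :
    fderiv ℝ (fun z => deck f n (G z)) z e = deckLin f n (fderiv ℝ G z e) := by
  have h : HasFDerivAt (fun z => deck f n (G z)) _ z :=
    (hasFDerivAt_deck f n (G z)).comp z (hG.differentiable (by simp) z).hasFDerivAt
  rw [h.fderiv]
  rfl

/-- Only finitely many translates of a compact set come near to the fiber over `s₀`. -/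
theorem exists_finset_far {X : Type*} [TopologicalSpace X] {S : Set X} (hS : IsCompact S)
    {G : X → ℝ × (Fin 2 → ℝ)} (hG : Continuous G) (s₀ : ℝ) :
    ∃ F : Finset ℤ, ∀ n ∉ F, ∀ z ∈ S, 2 < |(deck f n (G z)).1 - s₀| := by
  obtain ⟨B, hB⟩ := hS.exists_bound_of_continuousOn (f := fun z => (G z).1 - s₀)
    (hG.fst.sub continuous_const).continuousOn
  refine ⟨Finset.Icc (-(⌈B⌉ + 3)) (⌈B⌉ + 3), fun n hn z hz => ?_⟩
  have h1 : ⌈B⌉ + 3 < |n| := by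
    by_contra h
    exact hn (Finset.mem_Icc.2 (abs_le.1 (not_lt.1 h)))
  have h2 : (⌈B⌉ : ℝ) + 3 < |(n : ℝ)| := by exact_mod_cast h1
  have h3 := Int.le_ceil B
  have h4 : |(G z).1 - s₀| ≤ B := hB z hz
  have h5 : |(n : ℝ)| ≤ |(deck f n (G z)).1 - s₀| + |(G z).1 - s₀| := by
    have : (n : ℝ) = ((deck f n (G z)).1 - s₀) - ((G z).1 - s₀) := by simp [deck]
    nth_rw 1 [this]
    exact abs_sub _ _
  linarith

namespace DualData

variable (Ω : DualData f)

/-- Coordinates transversal to the geodesic. -/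
def coord (x : ℝ × (Fin 2 → ℝ)) : ℝ × ℝ := (x.1 - Ω.s₀, sympDual Ω.b (x.2 - Ω.q))

theorem contDiff_coord : ContDiff ℝ ∞ Ω.coord :=
  (contDiff_fst.sub contDiff_const).prodMk
    ((sympDual Ω.b).contDiff.comp (contDiff_snd.sub contDiff_const))

theorem fderiv_coord_comp {G : ℝ × ℝ → ℝ × (Fin 2 → ℝ)} {z : ℝ × ℝ}
    (hG : DifferentiableAt ℝ G z) (e : ℝ × ℝ) :
    fderiv ℝ (fun z => Ω.coord (G z)) z e =
      ((fderiv ℝ G z e).1, sympDual Ω.b (fderiv ℝ G z e).2) := by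
  have h : HasFDerivAt Ω.coord ((ContinuousLinearMap.id ℝ ℝ).prodMap (sympDual Ω.b)) (G z) := by
    have : Ω.coord = fun x => (ContinuousLinearMap.id ℝ ℝ).prodMap (sympDual Ω.b) x +
        (-Ω.s₀, -sympDual Ω.b Ω.q) := by
      funext x
      refine Prod.ext ?_ ?_ <;> simp [coord, sub_eq_add_neg]
    rw [this]
    exact (ContinuousLinearMap.hasFDerivAt _).add_const _
  have h2 : HasFDerivAt (fun z => Ω.coord (G z)) _ z := h.comp z hG.hasFDerivAt
  rw [h2.fderiv]
  rfl

/-- The side `u = 0` is collapsed to a point and contributes nothing; the other three sides carry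
the signs of the simplicial boundary. -/
theorem pathIntegral_square (r : ℝ) {G : ℝ × ℝ → ℝ × (Fin 2 → ℝ)} (hG : ContDiff ℝ ∞ G)
    (h0 : ∀ v v', G (0, v) = G (0, v')) :
    Ω.pathIntegral r (fun t => G (1, t)) - Ω.pathIntegral r (fun t => G (t, 1)) +
      Ω.pathIntegral r (fun t => G (t, 0)) =
    ∫ z in Icc (0 : ℝ × ℝ) 1,
      (fderiv ℝ (Ω.form r) (G z) (fderiv ℝ G z (1, 0)) (fderiv ℝ G z (0, 1)) -
        fderiv ℝ (Ω.form r) (G z) (fderiv ℝ G z (0, 1)) (fderiv ℝ G z (1, 0))) := by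
  have hd : ∀ z, HasFDerivAt G (fderiv ℝ G z) z := fun z =>
    (hG.differentiable (by simp) z).hasFDerivAt
  have hv : ∀ u v : ℝ, deriv (fun v => G (u, v)) v = fderiv ℝ G (u, v) (0, 1) := fun u v =>
    ((hd (u, v)).comp_hasDerivAt v ((hasDerivAt_const v u).prodMk (hasDerivAt_id v))).deriv
  have hu : ∀ u v : ℝ, deriv (fun u => G (u, v)) u = fderiv ℝ G (u, v) (1, 0) := fun u v =>
    ((hd (u, v)).comp_hasDerivAt u ((hasDerivAt_id u).prodMk (hasDerivAt_const u v))).deriv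
  have hz : ∀ v, fderiv ℝ G (0, v) (0, 1) = 0 := fun v => by
    rw [← hv]
    have : (fun v => G (0, v)) = fun _ => G (0, 0) := funext fun v => h0 v 0
    rw [this, deriv_const]
  rw [stokes_square (Ω.contDiff_form r) (hG.of_le (by norm_cast))]
  simp only [pathIntegral, hu, hv, hz, map_zero, intervalIntegral.integral_zero, sub_zero]

/-- Stokes is applied to each translate. The integrals of `telescope` have finite support in `n`, so
their shifted and unshifted sums agree and cancel, leaving the density integrals. -/
theorem finsum_pathIntegral_square {r : ℝ} (h0 : 0 < r) (h1 : r < 1)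
    {G : ℝ × ℝ → ℝ × (Fin 2 → ℝ)} (hG : ContDiff ℝ ∞ G) (hG0 : ∀ v v', G (0, v) = G (0, v'))
    {F : Finset ℤ} (hF : ∀ n ∉ F, ∀ z ∈ Icc (0 : ℝ × ℝ) 1, 2 < |(deck f n (G z)).1 - Ω.s₀|) :
    Ω.liftPairing r (fun t => G (1, t)) - Ω.liftPairing r (fun t => G (t, 1)) +
      Ω.liftPairing r (fun t => G (t, 0)) =
    ∑ n ∈ F, ∫ z in Icc (0 : ℝ × ℝ) 1, density Ω.d r (Ω.coord (deck f n (G z))) *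
      (fderiv ℝ (fun z => Ω.coord (deck f n (G z))) z).det := by
  have hfin : ∀ γ : ℝ → ℝ × ℝ, (∀ t ∈ Icc (0 : ℝ) 1, γ t ∈ Icc (0 : ℝ × ℝ) 1) →
      (Function.support fun n : ℤ => Ω.pathIntegral r fun t => deck f n (G (γ t))).Finite := by
    intro γ hγ
    refine F.finite_toSet.subset fun n hn => ?_
    by_contra hnF
    exact hn (Ω.pathIntegral_eq_zero h0 h1 fun t ht => hF n hnF _ (hγ t ht))
  have f0 := hfin (fun t => (1, t)) fun t ht => ⟨⟨zero_le_one, ht.1⟩, le_rfl, ht.2⟩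
  have f1 := hfin (fun t => (t, 1)) fun t ht => ⟨⟨ht.1, zero_le_one⟩, ht.2, le_rfl⟩
  have f2 := hfin (fun t => (t, 0)) fun t ht => ⟨⟨ht.1, le_rfl⟩, ht.2, zero_le_one⟩
  simp only [liftPairing]
  rw [← finsum_sub_distrib f0 f1, ← finsum_add_distrib
    ((f0.union f1).subset (Function.support_sub _ _)) f2]
  set T : ℤ → ℝ × ℝ → ℝ := fun n z => Ω.telescope r (deck f n (G z))
    (deckLin f n (fderiv ℝ G z (1, 0))) (deckLin f n (fderiv ℝ G z (0, 1))) with hT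
  set D : ℤ → ℝ × ℝ → ℝ := fun n z => density Ω.d r (Ω.coord (deck f n (G z))) *
      (fderiv ℝ (fun z => Ω.coord (deck f n (G z))) z).det with hD
  have hGn : ∀ n, ContDiff ℝ ∞ fun z => deck f n (G z) := fun n => (contDiff_deck f n).comp hG
  have hdG : ∀ e, Continuous fun z => fderiv ℝ G z e := fun e =>
    (hG.continuous_fderiv (by simp)).clm_apply continuous_const
  have hTc : ∀ n, Continuous (T n) := fun n => by
    have h1 : Continuous fun z => bump r ((deck f n (G z)).1 - Ω.s₀) :=
      (contDiff_bump r).continuous.comp ((hGn n).continuous.fst.sub continuous_const)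
    have h2 : ∀ e, Continuous fun z => deckLin f n (fderiv ℝ G z e) := fun e =>
      (deckLin f n).continuous.comp (hdG e)
    have h3 : ∀ e, Continuous fun z => Ω.c (linMap f⁻¹ (deckLin f n (fderiv ℝ G z e)).2) :=
      fun e => Ω.c.continuous.comp ((linMap f⁻¹).continuous.comp (h2 e).snd)
    exact h1.mul (((h2 _).fst.mul (h3 _)).sub ((h2 _).fst.mul (h3 _)))
  have hcoord : ∀ n, ContDiff ℝ ∞ fun z => Ω.coord (deck f n (G z)) := fun n =>
    Ω.contDiff_coord.comp (hGn n)
  have hDc : ∀ n, Continuous (D n) := fun n =>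
    ((continuous_density _ _).comp (hcoord n).continuous).mul
      (ContinuousLinearMap.continuous_det.comp ((hcoord n).continuous_fderiv (by simp)))
  have hint : ∀ {g : ℝ × ℝ → ℝ}, Continuous g → IntegrableOn g (Icc (0 : ℝ × ℝ) 1) := fun hg =>
    hg.integrableOn_Icc
  have hb : ∀ n ∉ F, ∀ z ∈ Icc (0 : ℝ × ℝ) 1, bump r ((deck f n (G z)).1 - Ω.s₀) = 0 :=
    fun n hn z hz => bump_of_lt_abs h0 (by linarith [hF n hn z hz])
  have hTF : ∀ n ∉ F, ∫ z in Icc (0 : ℝ × ℝ) 1, T n z = 0 := fun n hn =>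
    setIntegral_eq_zero_of_forall_eq_zero fun z hz => by
      simp only [hT, telescope, hb n hn z hz, zero_mul]
  have hDF : ∀ n ∉ F, ∫ z in Icc (0 : ℝ × ℝ) 1, D n z = 0 := fun n hn =>
    setIntegral_eq_zero_of_forall_eq_zero fun z hz => by
      simp only [hD, density, coord, hb n hn z hz, zero_mul]
  have key : ∀ n : ℤ, (Ω.pathIntegral r fun t => deck f n (G (1, t))) -
      (Ω.pathIntegral r fun t => deck f n (G (t, 1))) +
      (Ω.pathIntegral r fun t => deck f n (G (t, 0))) =
      (∫ z in Icc (0 : ℝ × ℝ) 1, T (Equiv.addRight 1 n) z) - (∫ z in Icc (0 : ℝ × ℝ) 1, T n z) +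
        ∫ z in Icc (0 : ℝ × ℝ) 1, D n z := by
    intro n
    have hs : Continuous fun z => T (Equiv.addRight 1 n) z - T n z := (hTc _).sub (hTc _)
    rw [Ω.pathIntegral_square r (hGn n) fun v v' => by rw [hG0 v v'],
      ← integral_sub (hint (hTc _)) (hint (hTc _)), ← integral_add (hint hs) (hint (hDc _))]
    refine setIntegral_congr_fun measurableSet_Icc fun z _ => ?_
    have hlin : ∀ u, deckLin f 1 (deckLin f n u) = deckLin f (n + 1) u := fun u => by
      refine Prod.ext ?_ ?_
      · simp [deckLin]
      · simp only [deckLin, ContinuousLinearMap.coe_prodMap', Prod.map_snd]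
        rw [← linMap_mul, ← zpow_add, add_comm]
    simp only [Ω.curl_form, hT, hD, fderiv_deck_comp hG, Equiv.coe_addRight, hlin, deck_deck,
      add_comm 1 n, det_prod_eq,
      Ω.fderiv_coord_comp ((hGn n).differentiable (by simp) z)]
    rfl
  have s0 : (Function.support fun n => ∫ z in Icc (0 : ℝ × ℝ) 1, T n z).Finite :=
    F.finite_toSet.subset fun n hn => by
      by_contra hnF
      exact hn (hTF n hnF)
  have s1 : (Function.support fun n => ∫ z in Icc (0 : ℝ × ℝ) 1, T (Equiv.addRight 1 n) z).Finite :=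
    s0.preimage (Equiv.addRight (1 : ℤ)).injective.injOn
  have s2 : (Function.support fun n => ∫ z in Icc (0 : ℝ × ℝ) 1, D n z) ⊆ F := fun n hn => by
    by_contra hnF
    exact hn (hDF n hnF)
  rw [finsum_congr key, finsum_add_distrib ((s1.union s0).subset (Function.support_sub _ _))
    (F.finite_toSet.subset s2), finsum_sub_distrib s1 s0,
    finsum_comp_equiv (Equiv.addRight (1 : ℤ)) (f := fun n => ∫ z in Icc (0 : ℝ × ℝ) 1, T n z),
    sub_self, zero_add, finsum_eq_sum_of_support_subset _ s2]

/-- The finite set of relevant translates is chosen before `r`, so that the limit of small `r` can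
be taken term by term. -/
theorem exists_finset_chainPairing {σ : Simplex 2 (SolManifold f)}
    {K : (Fin 3 → ℝ) → ℝ × (Fin 2 → ℝ)} (hK : IsSmoothLift σ K) :
    ∃ F : Finset ℤ, (∀ n ∉ F, ∀ z ∈ Icc (0 : ℝ × ℝ) 1,
        2 < |(deck f n (K (duffy z))).1 - Ω.s₀|) ∧
      ∀ r, 0 < r → r < 1 → Ω.chainPairing r (boundary 1 (Finsupp.single σ 1)) =
        ∑ n ∈ F, ∫ z in Icc (0 : ℝ × ℝ) 1,
          density Ω.d r (Ω.coord (deck f n (K (duffy z)))) *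
            (fderiv ℝ (fun z => Ω.coord (deck f n (K (duffy z)))) z).det := by
  have hG : ContDiff ℝ ∞ fun z => K (duffy z) := hK.1.comp contDiff_duffy
  obtain ⟨F, hF⟩ := exists_finset_far (f := f) (isCompact_Icc (a := (0 : ℝ × ℝ)) (b := 1))
    hG.continuous Ω.s₀
  refine ⟨F, hF, fun r h0 h1 => ?_⟩
  rw [← Ω.finsum_pathIntegral_square h0 h1 hG (fun v v' => by simp [duffy]) hF]
  have e0 : Ω.simplexPairing r (face 0 σ) = Ω.liftPairing r fun t => K (duffy (1, t)) :=
    (Ω.simplexPairing_eq h0 (hK.face 0)).trans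
      (congrArg _ (funext fun t => congrArg K (face_param_zero t)))
  have e1 : Ω.simplexPairing r (face 1 σ) = Ω.liftPairing r fun t => K (duffy (t, 1)) :=
    (Ω.simplexPairing_eq h0 (hK.face 1)).trans
      (congrArg _ (funext fun t => congrArg K (face_param_one t)))
  have e2 : Ω.simplexPairing r (face 2 σ) = Ω.liftPairing r fun t => K (duffy (t, 0)) :=
    (Ω.simplexPairing_eq h0 (hK.face 2)).trans
      (congrArg _ (funext fun t => congrArg K (face_param_two t)))
  rw [← e0, ← e1, ← e2]
  simp [chainPairing, boundary, Fin.sum_univ_three, sub_eq_add_neg]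

end DualData

end SolLinking

end

/-! ### Crossings in fixed lifts, and multiplicities along the geodesic -/

noncomputable section

namespace SolLinking

open MeasureTheory Set Filter Topology

variable {f : SL(2, ℤ)}

/-! ### Crossings in terms of fixed lifts -/

theorem eventually_mem_stdSimplex {k : ℕ} {x : Fin (k + 1) → ℝ}
    (hx : x ∈ stdSimplex ℝ (Fin (k + 1))) (hpos : ∀ i, 0 < x i) (i : Fin (k + 1)) :
    ∀ᶠ t in 𝓝 (0 : ℝ), x + t • edge i ∈ stdSimplex ℝ (Fin (k + 1)) := by
  have h : ∀ j, ∀ᶠ t in 𝓝 (0 : ℝ), 0 < (x + t • edge i) j := fun j => by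
    have hc : Continuous fun t : ℝ => (x + t • (edge i : Fin (k + 1) → ℝ)) j := by
      simp only [Pi.add_apply, Pi.smul_apply, smul_eq_mul]
      fun_prop
    exact hc.tendsto 0 |>.eventually (lt_mem_nhds (by simpa using hpos j))
  filter_upwards [eventually_all.2 h] with t ht
  refine ⟨fun j => (ht j).le, ?_⟩
  have he : ∑ j, (edge i : Fin (k + 1) → ℝ) j = 0 := by
    simp [edge, Finset.sum_sub_distrib]
  simp only [Pi.add_apply, Pi.smul_apply, Finset.sum_add_distrib, ← Finset.smul_sum, he, hx.2,
    smul_zero, add_zero]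

/-- The simplex lies in a hyperplane of the ambient space, so maps agreeing on it need not have the
same full derivative. Derivatives along edges at interior points are nevertheless determined. -/
theorem fderiv_edge_congr {k : ℕ} {K K' : (Fin (k + 1) → ℝ) → ℝ × (Fin 2 → ℝ)}
    (hK : ContDiff ℝ ∞ K) (hK' : ContDiff ℝ ∞ K') (h : EqOn K K' (stdSimplex ℝ (Fin (k + 1))))
    {x : Fin (k + 1) → ℝ} (hx : x ∈ stdSimplex ℝ (Fin (k + 1))) (hpos : ∀ i, 0 < x i)
    (i : Fin (k + 1)) : fderiv ℝ K x (edge i) = fderiv ℝ K' x (edge i) := by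
  have hp : HasDerivAt (fun t : ℝ => x + t • (edge i : Fin (k + 1) → ℝ)) (edge i) 0 := by
    simpa using ((hasDerivAt_id (0 : ℝ)).smul_const (edge i : Fin (k + 1) → ℝ)).const_add x
  have hd : ∀ {G : (Fin (k + 1) → ℝ) → ℝ × (Fin 2 → ℝ)}, ContDiff ℝ ∞ G →
      HasDerivAt (fun t : ℝ => G (x + t • edge i)) (fderiv ℝ G x (edge i)) 0 := fun {G} hG => by
    have h1 : HasFDerivAt G (fderiv ℝ G x) (x + (0 : ℝ) • edge i) := by
      rw [zero_smul, add_zero]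
      exact (hG.differentiable (by simp) x).hasFDerivAt
    exact h1.comp_hasDerivAt 0 hp
  have he : (fun t : ℝ => K (x + t • edge i)) =ᶠ[𝓝 0] fun t => K' (x + t • edge i) := by
    filter_upwards [eventually_mem_stdSimplex hx hpos i] with t ht using h ht
  exact (hd hK).unique ((hd hK').congr_of_eventuallyEq he)

theorem frameDet_deckLin (n : ℤ) (u v w : ℝ × (Fin 2 → ℝ)) :
    frameDet (deckLin f n u) (deckLin f n v) (deckLin f n w) = frameDet u v w := by
  simp [frameDet_eq, deckLin, symp_linMap]

theorem deckLin_deckLin (m n : ℤ) (u : ℝ × (Fin 2 → ℝ)) :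
    deckLin f m (deckLin f n u) = deckLin f (m + n) u := by
  refine Prod.ext ?_ ?_
  · simp [deckLin]
  · simp only [deckLin, ContinuousLinearMap.coe_prodMap', Prod.map_snd]
    rw [← linMap_mul, ← zpow_add]

/-- The crossing determinant of the `n`-th translate of `K` and a geodesic in direction `b`. -/
def translateDet (f : SL(2, ℤ)) (K : (Fin 3 → ℝ) → ℝ × (Fin 2 → ℝ)) (b : Fin 2 → ℤ) (n : ℤ)
    (x : Fin 3 → ℝ) : ℝ :=
  frameDet (deckLin f n (fderiv ℝ K x (edge 1))) (deckLin f n (fderiv ℝ K x (edge 2)))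
    (0, intVec b)

/-- The crossings of a simplex and a geodesic, in terms of fixed lifts. -/
theorem exists_lifts_iff {σ : Simplex 2 (SolManifold f)} {K : (Fin 3 → ℝ) → ℝ × (Fin 2 → ℝ)}
    (hK : IsSmoothLift σ K) (s₀ : ℝ) (q : Fin 2 → ℝ) (b : Fin 2 → ℤ) (P : ℝ → Prop)
    {x : Fin 3 → ℝ} (hx : x ∈ stdSimplex ℝ (Fin 3)) (hxpos : ∀ i, 0 < x i)
    {t : Fin 2 → ℝ} (ht : t ∈ stdSimplex ℝ (Fin 2)) (htpos : ∀ i, 0 < t i) :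
    (∃ K' L', IsSmoothLift σ K' ∧ IsSmoothLift (geodesic f s₀ (toTorus q) b) L' ∧ K' x = L' t ∧
      P (crossingDet K' L' x t)) ↔
    ∃ (n : ℤ) (v : Fin 2 → ℤ), deck f n (K x) = geodesicLift s₀ q b t + (0, intVec v) ∧
      P (translateDet f K b n x) := by
  have hL := isSmoothLift_geodesicLift f s₀ q b
  have he : (edge 1 : Fin 2 → ℝ) 1 = 1 := by simp [edge]
  constructor
  · rintro ⟨K', L', hK', hL', h, hP⟩
    obtain ⟨m, v, hm⟩ := exists_deck_of_lifts hK hK'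
    obtain ⟨m', v', hm'⟩ := exists_deck_of_lifts hL hL'
    have dK : ∀ i, fderiv ℝ K' x (edge i) = deckLin f m (fderiv ℝ K x (edge i)) := fun i => by
      rw [fderiv_edge_congr hK'.1 (hK.deck_add m v).1 hm hx hxpos i, fderiv_add_const,
        fderiv_deck_comp hK.1]
    have dL : fderiv ℝ L' t (edge 1) = deckLin f m' (0, intVec b) := by
      rw [fderiv_edge_congr hL'.1 (hL.deck_add m' v').1 hm' ht htpos 1, fderiv_add_const,
        fderiv_deck_comp hL.1, fderiv_geodesicLift, he, one_smul]
    rw [hm x hx, hm' t ht] at h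
    -- Both lifts are moved by `deck f (-m')`, which returns the geodesic to its standard lift up to
    -- an integral translation and preserves the frame determinant.
    refine ⟨-m' + m, (f ^ (-m')).1.mulVec (v' - v), ?_, ?_⟩
    · have h1 : deck f m (K x) = deck f m' (geodesicLift s₀ q b t) + (0, intVec (v' - v)) := by
        have h2 : intVec (v' - v) = intVec v' - intVec v := by
          funext i; simp [intVec]
        have h3 : ((0, intVec v' - intVec v) : ℝ × (Fin 2 → ℝ)) =
            (0, intVec v') - (0, intVec v) := by simp
        rw [h2, h3, add_sub, ← h, add_sub_cancel_right]
      have h4 : intVec ((f ^ (-m')).1.mulVec (v' - v)) = linMap (f ^ (-m')) (intVec (v' - v)) := by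
        funext i
        simp [linMap_apply, intVec, Matrix.mulVec, dotProduct, Fin.sum_univ_two]
      have h5 : ∀ (y : ℝ × (Fin 2 → ℝ)) w,
          deck f (-m') (y + (0, w)) = deck f (-m') y + (0, linMap (f ^ (-m')) w) := fun y w => by
        refine Prod.ext ?_ ?_ <;> simp [deck]
      rw [← deck_deck, h1, h5, deck_deck, neg_add_cancel, deck_zero, h4]
    · have h1 : translateDet f K b (-m' + m) x = crossingDet K' L' x t := by
        have h2 : deckLin f 0 (0, intVec b) = (0, intVec b) := by
          refine Prod.ext ?_ ?_ <;> simp [deckLin, linMap_one]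
        rw [crossingDet, dK, dK, dL, ← frameDet_deckLin (f := f) (-m'), deckLin_deckLin,
          deckLin_deckLin, deckLin_deckLin, neg_add_cancel, h2, translateDet]
      rwa [h1]
  · rintro ⟨n, v, h, hP⟩
    refine ⟨fun y => deck f n (K y) + (0, intVec 0), fun y => geodesicLift s₀ q b y + (0, intVec v),
      hK.deck_add n 0, ?_, ?_, ?_⟩
    · have := hL.deck_add 0 v
      simpa only [deck_zero] using this
    · have h0 : intVec 0 = 0 := by funext i; simp [intVec]
      change deck f n (K x) + (0, intVec 0) = geodesicLift s₀ q b t + (0, intVec v)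
      rw [h, h0]
      simp
    · rwa [crossingDet, fderiv_add_const, fderiv_add_const, fderiv_deck_comp hK.1,
        fderiv_deck_comp hK.1, fderiv_geodesicLift, he, one_smul]

/-! ### Points of a geodesic over a point of its image -/

/-- Write `b = d (c0, c1)` with `(c0, c1)` primitive and `α c0 + β c1 = 1`. Then `ρ = α y₀ + β y₁`
is the coordinate of `y` along the primitive vector modulo integral translations, and the condition
on `t` is `t d ≡ ρ` modulo `1`. -/
theorem exists_line_param {b : Fin 2 → ℤ} (hb : b ≠ 0) {y : Fin 2 → ℝ} {k : ℤ}
    (hy : sympDual b y = k * (Int.gcd (b 0) (b 1) : ℝ)) :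
    ∃ ρ : ℝ, ∀ t : ℝ, (∃ v, y = t • intVec b + intVec v) ↔
      ∃ m : ℤ, ρ - t * (Int.gcd (b 0) (b 1) : ℝ) = m := by
  set d : ℕ := Int.gcd (b 0) (b 1) with hd
  have hd0 : 0 < d := by
    refine Nat.pos_of_ne_zero fun h => hb (funext fun i => ?_)
    have := Int.gcd_eq_zero_iff.1 h
    fin_cases i
    exacts [this.1, this.2]
  have hdR : (d : ℝ) ≠ 0 := by exact_mod_cast hd0.ne'
  obtain ⟨c0, h0⟩ := Int.gcd_dvd_left (a := b 0) (b := b 1)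
  obtain ⟨c1, h1⟩ := Int.gcd_dvd_right (a := b 0) (b := b 1)
  rw [← hd] at h0 h1
  obtain ⟨α, β, hαβ⟩ : ∃ α β : ℤ, α * c0 + β * c1 = 1 := by
    refine ⟨Int.gcdA (b 0) (b 1), Int.gcdB (b 0) (b 1), ?_⟩
    have h := Int.gcd_eq_gcd_ab (b 0) (b 1)
    rw [← hd] at h
    have h2 : (d : ℤ) * (Int.gcdA (b 0) (b 1) * c0 + Int.gcdB (b 0) (b 1) * c1) = d * 1 := by
      linear_combination Int.gcdA (b 0) (b 1) * (-h0) - Int.gcdB (b 0) (b 1) * h1 - h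
    exact mul_left_cancel₀ (by exact_mod_cast hd0.ne') h2
  have h0R : (b 0 : ℝ) = d * c0 := by exact_mod_cast h0
  have h1R : (b 1 : ℝ) = d * c1 := by exact_mod_cast h1
  have hR : (α : ℝ) * c0 + β * c1 = 1 := by exact_mod_cast hαβ
  have hyk : y 0 * c1 - y 1 * c0 = k := by
    rw [sympDual_apply, symp] at hy
    simp only [intVec, h0R, h1R] at hy
    have : (d : ℝ) * (y 0 * c1 - y 1 * c0) = d * k := by linear_combination hy
    exact mul_left_cancel₀ hdR this
  have e0 : y 0 = (α * y 0 + β * y 1) * c0 + β * k := by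
    linear_combination β * hyk - y 0 * hR
  have e1 : y 1 = (α * y 0 + β * y 1) * c1 - α * k := by
    linear_combination -α * hyk - y 1 * hR
  refine ⟨α * y 0 + β * y 1, fun t => ⟨?_, ?_⟩⟩
  · rintro ⟨v, hv⟩
    have v0 := congrFun hv 0
    have v1 := congrFun hv 1
    simp only [Pi.add_apply, Pi.smul_apply, smul_eq_mul, intVec, h0R, h1R] at v0 v1
    refine ⟨α * v 0 + β * v 1, ?_⟩
    push_cast
    linear_combination (α : ℝ) * v0 + β * v1 + t * d * hR
  · rintro ⟨m, hm⟩
    refine ⟨![m * c0 + β * k, m * c1 - α * k], funext fun i => ?_⟩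
    fin_cases i
    · simp only [Pi.add_apply, Pi.smul_apply, smul_eq_mul, intVec, h0R, Fin.zero_eta,
        Matrix.cons_val_zero]
      push_cast
      linear_combination e0 + c0 * hm
    · simp only [Pi.add_apply, Pi.smul_apply, smul_eq_mul, intVec, h1R, Fin.mk_one,
        Matrix.cons_val_one]
      push_cast
      linear_combination e1 + c1 * hm

theorem exists_line_point {b : Fin 2 → ℤ} (hb : b ≠ 0) {y : Fin 2 → ℝ} {k : ℤ}
    (hy : sympDual b y = k * (Int.gcd (b 0) (b 1) : ℝ)) :
    ∃ t ∈ Icc (0 : ℝ) 1, ∃ v, y = t • intVec b + intVec v := by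
  have hd0 : 0 < Int.gcd (b 0) (b 1) := by
    refine Nat.pos_of_ne_zero fun h => hb (funext fun i => ?_)
    have := Int.gcd_eq_zero_iff.1 h
    fin_cases i
    exacts [this.1, this.2]
  have hd1 : (1 : ℝ) ≤ (Int.gcd (b 0) (b 1) : ℝ) := by exact_mod_cast hd0
  obtain ⟨ρ, hρ⟩ := exists_line_param hb hy
  refine ⟨Int.fract ρ / (Int.gcd (b 0) (b 1) : ℝ), ⟨?_, ?_⟩, (hρ _).2 ⟨⌊ρ⌋, ?_⟩⟩
  · exact div_nonneg (Int.fract_nonneg _) (by linarith)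
  · rw [div_le_one (by linarith)]
    linarith [Int.fract_lt_one ρ]
  · rw [div_mul_cancel₀ _ (by linarith), Int.self_sub_fract]

/-- The solutions are spaced by `1 / d`. Excluding integral `y` excludes the end points `t = 0, 1`,
which would otherwise give `d + 1` solutions. -/
theorem ncard_line_points {b : Fin 2 → ℤ} (hb : b ≠ 0) {y : Fin 2 → ℝ} {k : ℤ}
    (hy : sympDual b y = k * (Int.gcd (b 0) (b 1) : ℝ)) (h0 : ¬∃ v, y = intVec v) :
    {t ∈ Icc (0 : ℝ) 1 | ∃ v, y = t • intVec b + intVec v}.Finite ∧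
    {t ∈ Icc (0 : ℝ) 1 | ∃ v, y = t • intVec b + intVec v}.ncard = Int.gcd (b 0) (b 1) := by
  obtain ⟨ρ, hρ⟩ := exists_line_param hb hy
  have hd0 : 0 < Int.gcd (b 0) (b 1) := by
    refine Nat.pos_of_ne_zero fun h => hb (funext fun i => ?_)
    have := Int.gcd_eq_zero_iff.1 h
    fin_cases i
    exacts [this.1, this.2]
  set d := Int.gcd (b 0) (b 1) with hd
  have hdR : (0 : ℝ) < d := by exact_mod_cast hd0
  have hρ0 : ∀ m : ℤ, ρ ≠ m := fun m hm => h0 (by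
    obtain ⟨v, hv⟩ := (hρ 0).2 ⟨m, by linarith⟩
    exact ⟨v, by simpa using hv⟩)
  have hset : {t ∈ Icc (0 : ℝ) 1 | ∃ v, y = t • intVec b + intVec v} =
      ((Finset.range d).image fun j : ℕ => (Int.fract ρ + j) / (d : ℝ) : Finset ℝ) := by
    ext t
    simp only [Finset.coe_image, Finset.coe_range, mem_image, mem_Iio, mem_ofPred_eq, hρ]
    constructor
    · rintro ⟨⟨ht0, ht1⟩, m, hm⟩
      have hfr := Int.fract_lt_one ρ
      have hfr0 := Int.fract_nonneg ρ
      have hfl := Int.self_sub_fract ρ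
      have htd : t * d = Int.fract ρ + (⌊ρ⌋ - m : ℤ) := by push_cast; linarith
      have h1 : 0 ≤ t * d := mul_nonneg ht0 hdR.le
      have h2 : t * d ≤ d := by nlinarith
      have hfrpos : 0 < Int.fract ρ := lt_of_le_of_ne hfr0 fun h => hρ0 ⌊ρ⌋ (by linarith)
      have h3 : (-1 : ℝ) < (⌊ρ⌋ - m : ℤ) := by linarith
      have h4 : ((⌊ρ⌋ - m : ℤ) : ℝ) < (d : ℤ) := by push_cast at htd ⊢; linarith
      have h3' : -1 < ⌊ρ⌋ - m := by exact_mod_cast h3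
      have h4' : ⌊ρ⌋ - m < d := by exact_mod_cast h4
      refine ⟨(⌊ρ⌋ - m).toNat, by omega, ?_⟩
      rw [div_eq_iff hdR.ne', htd]
      congr 1
      have : ((⌊ρ⌋ - m).toNat : ℤ) = ⌊ρ⌋ - m := Int.toNat_of_nonneg (by omega)
      exact_mod_cast this
    · rintro ⟨j, hj, rfl⟩
      have hj' : (j : ℝ) + 1 ≤ d := by exact_mod_cast hj
      refine ⟨⟨?_, ?_⟩, ⌊ρ⌋ - j, ?_⟩
      · exact div_nonneg (add_nonneg (Int.fract_nonneg _) (Nat.cast_nonneg _)) hdR.le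
      · rw [div_le_one hdR]
        linarith [Int.fract_lt_one ρ]
      · rw [div_mul_cancel₀ _ hdR.ne']
        push_cast
        linarith [Int.self_sub_fract ρ]
  rw [hset]
  refine ⟨Finset.finite_toSet _, ?_⟩
  rw [ncard_coe_finset, Finset.card_image_of_injective, Finset.card_range]
  intro i j hij
  have := (div_left_inj' hdR.ne').1 hij
  exact_mod_cast add_left_cancel this

theorem ncard_biUnion {ι α : Type*} {I : Set ι} (hI : I.Finite) {S : ι → Set α}
    (hS : ∀ i ∈ I, (S i).Finite) (hd : I.PairwiseDisjoint S) :
    (⋃ i ∈ I, S i).ncard = ∑ i ∈ hI.toFinset, (S i).ncard := by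
  have h := finsum_mem_biUnion (f := fun _ => 1) hd hI hS
  have hc : ∀ {s : Set α}, s.Finite → ∑ᶠ _ ∈ s, 1 = s.ncard := fun {s} hs => by
    rw [finsum_mem_eq_finite_toFinset_sum _ hs, Finset.sum_const, smul_eq_mul, mul_one,
      ncard_eq_toFinset_card _ hs]
  rw [hc (hI.biUnion hS), finsum_mem_eq_finite_toFinset_sum _ hI] at h
  rw [h]
  exact Finset.sum_congr rfl fun i hi => hc (hS i (hI.mem_toFinset.1 hi))

end SolLinking

end

/-! ### Transversal charts along a 2-simplex -/

noncomputable section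

namespace SolLinking

open MeasureTheory Set Filter Topology

variable {f : SL(2, ℤ)}

/-! ### The crossing number as a sum of integrals -/

theorem fderiv_duffy_fst (z : ℝ × ℝ) :
    fderiv ℝ duffy z (1, 0) = (1 - z.2) • edge 1 + z.2 • edge 2 := by
  have h1 : HasDerivAt (fun u : ℝ => duffy (u, z.2)) (fderiv ℝ duffy z (1, 0)) z.1 :=
    HasFDerivAt.comp_hasDerivAt (l := duffy) (f := fun u => ((u : ℝ), z.2)) z.1
      (contDiff_duffy.differentiable (by simp) z).hasFDerivAt
      ((hasDerivAt_id z.1).prodMk (hasDerivAt_const z.1 z.2))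
  have h2 : HasDerivAt (fun u : ℝ => duffy (u, z.2)) ((1 - z.2) • edge 1 + z.2 • edge 2) z.1 := by
    have e : (fun u : ℝ => duffy (u, z.2)) = fun u : ℝ =>
        Pi.single 0 1 + u • ((1 - z.2) • edge 1 + z.2 • edge 2 : Fin 3 → ℝ) := by
      funext u i
      fin_cases i <;> simp [duffy, edge]
      ring
    rw [e]
    simpa only [one_smul, id_eq] using ((hasDerivAt_id z.1).smul_const
      ((1 - z.2) • edge 1 + z.2 • edge 2 : Fin 3 → ℝ)).const_add (Pi.single 0 1)
  exact h1.unique h2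

theorem fderiv_duffy_snd (z : ℝ × ℝ) :
    fderiv ℝ duffy z (0, 1) = z.1 • (edge 2 - edge 1) := by
  have h1 : HasDerivAt (fun u : ℝ => duffy (z.1, u)) (fderiv ℝ duffy z (0, 1)) z.2 :=
    HasFDerivAt.comp_hasDerivAt (l := duffy) (f := fun u => (z.1, (u : ℝ))) z.2
      (contDiff_duffy.differentiable (by simp) z).hasFDerivAt
      ((hasDerivAt_const z.2 z.1).prodMk (hasDerivAt_id z.2))
  have h2 : HasDerivAt (fun u : ℝ => duffy (z.1, u)) (z.1 • (edge 2 - edge 1)) z.2 := by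
    have e : (fun u : ℝ => duffy (z.1, u)) = fun u : ℝ =>
        duffy (z.1, 0) + u • (z.1 • (edge 2 - edge 1) : Fin 3 → ℝ) := by
      funext u i
      fin_cases i <;> simp [duffy, edge] <;> ring
    rw [e]
    simpa only [one_smul, id_eq] using ((hasDerivAt_id z.2).smul_const
      (z.1 • (edge 2 - edge 1) : Fin 3 → ℝ)).const_add (duffy (z.1, 0))
  exact h1.unique h2

theorem exists_duffy_eq {x : Fin 3 → ℝ} (hx : x ∈ stdSimplex ℝ (Fin 3)) (hpos : ∀ i, 0 < x i) :
    ∃ z ∈ Icc (0 : ℝ × ℝ) 1, 0 < z.1 ∧ duffy z = x := by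
  have hs : x 0 + x 1 + x 2 = 1 := by rw [← Fin.sum_univ_three]; exact hx.2
  have h0 := hpos 0
  have h1 := hpos 1
  have h2 := hpos 2
  have hz : 0 < x 1 + x 2 := by linarith
  refine ⟨(x 1 + x 2, x 2 / (x 1 + x 2)), ⟨⟨hz.le, (div_pos h2 hz).le⟩, ?_, ?_⟩, hz,
    funext fun i => ?_⟩
  · change x 1 + x 2 ≤ 1
    linarith
  · change x 2 / (x 1 + x 2) ≤ 1
    rw [div_le_one hz]
    linarith
  · fin_cases i
    · change 1 - (x 1 + x 2) = x 0
      linarith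
    · change (x 1 + x 2) * (1 - x 2 / (x 1 + x 2)) = x 1
      field_simp
      ring
    · change (x 1 + x 2) * (x 2 / (x 1 + x 2)) = x 2
      field_simp

theorem duffy_injective {z z' : ℝ × ℝ} (hz : z.1 ≠ 0) (h : duffy z = duffy z') : z = z' := by
  have h0 : 1 - z.1 = 1 - z'.1 := congrFun h 0
  have h1 : z.1 = z'.1 := by linarith
  have h2 : z.1 * z.2 = z'.1 * z'.2 := congrFun h 2
  rw [← h1] at h2
  exact Prod.ext h1 (mul_left_cancel₀ hz h2)

theorem mem_interior_of_duffy_pos {z : ℝ × ℝ} (hz : z ∈ Icc (0 : ℝ × ℝ) 1)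
    (h : ∀ i, 0 < duffy z i) : z ∈ interior (Icc (0 : ℝ × ℝ) 1) := by
  have h0 : 0 < 1 - z.1 := h 0
  have h1 : 0 < z.1 * (1 - z.2) := h 1
  have h2 : 0 < z.1 * z.2 := h 2
  have hz1 : 0 < z.1 := lt_of_le_of_ne hz.1.1 fun h => by
    rw [show z.1 = 0 from h.symm, zero_mul] at h2
    exact lt_irrefl _ h2
  have hz2 := (mul_pos_iff_of_pos_left hz1).1 h1
  have hz3 := (mul_pos_iff_of_pos_left hz1).1 h2
  refine mem_interior.2 ⟨Ioo 0 1 ×ˢ Ioo 0 1, ?_, isOpen_Ioo.prod isOpen_Ioo,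
    ⟨hz1, by linarith⟩, hz3, by linarith⟩
  exact fun w hw => ⟨⟨hw.1.1.le, hw.2.1.le⟩, hw.1.2.le, hw.2.2.le⟩

/-- A `2`-simplex meets a geodesic in interior points and transversally. -/
def IsTransversal (σ : Simplex 2 (SolManifold f)) (τ : Simplex 1 (SolManifold f)) : Prop :=
  ∀ x t, σ x = τ t →
    (∀ i, 0 < x.1 i) ∧ (∀ i, 0 < t.1 i) ∧ (PosCrossing σ τ (x, t) ∨ NegCrossing σ τ (x, t))

namespace DualData

variable (Ω : DualData f)

/-- The geodesic of the data. -/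
def curve : Simplex 1 (SolManifold f) := geodesic f Ω.s₀ (toTorus Ω.q) Ω.b

/-- The coordinates transversal to the geodesic along a translate of a `2`-simplex. -/
def chart (K : (Fin 3 → ℝ) → ℝ × (Fin 2 → ℝ)) (n : ℤ) (z : ℝ × ℝ) : ℝ × ℝ :=
  Ω.coord (deck f n (K (duffy z)))

/-- The factor `z.1` is the Jacobian of `duffy`. The differential of `coord` kills `(0, b)`, so its
Jacobian is the determinant of the frame completed by this vector. -/
theorem det_fderiv_chart {K : (Fin 3 → ℝ) → ℝ × (Fin 2 → ℝ)} (hK : ContDiff ℝ ∞ K) (n : ℤ)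
    (z : ℝ × ℝ) :
    (fderiv ℝ (Ω.chart K n) z).det = z.1 * translateDet f K Ω.b n (duffy z) := by
  have hG : ContDiff ℝ ∞ fun z => K (duffy z) := hK.comp contDiff_duffy
  have hGn : ContDiff ℝ ∞ fun z => deck f n (K (duffy z)) := (contDiff_deck f n).comp hG
  have hd : ∀ e, fderiv ℝ (fun z => K (duffy z)) z e =
      fderiv ℝ K (duffy z) (fderiv ℝ duffy z e) := fun e => by
    have h : HasFDerivAt (fun z => K (duffy z)) _ z :=
      (hK.differentiable (by simp) (duffy z)).hasFDerivAt.comp z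
        (contDiff_duffy.differentiable (by simp) z).hasFDerivAt
    rw [h.fderiv]
    rfl
  have hc : fderiv ℝ (Ω.chart K n) z =
      fderiv ℝ (fun z => Ω.coord (deck f n (K (duffy z)))) z := rfl
  rw [hc, det_prod_eq, Ω.fderiv_coord_comp (hGn.differentiable (by simp) z),
    Ω.fderiv_coord_comp (hGn.differentiable (by simp) z), fderiv_deck_comp hG, fderiv_deck_comp hG,
    hd, hd, fderiv_duffy_fst, fderiv_duffy_snd, translateDet, frameDet_eq]
  simp only [map_add, map_smul, map_sub, Prod.fst_add, Prod.snd_add, Prod.smul_fst, Prod.smul_snd,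
    Prod.fst_sub, Prod.snd_sub, smul_eq_mul, ← sympDual_apply]
  ring

theorem contDiff_chart {K : (Fin 3 → ℝ) → ℝ × (Fin 2 → ℝ)} (hK : ContDiff ℝ ∞ K) (n : ℤ) :
    ContDiff ℝ ∞ (Ω.chart K n) :=
  Ω.contDiff_coord.comp ((contDiff_deck f n).comp (hK.comp contDiff_duffy))

theorem coord_mem_lattice_of_eq {x : ℝ × (Fin 2 → ℝ)} {t : Fin 2 → ℝ} {v : Fin 2 → ℤ}
    (h : x = geodesicLift Ω.s₀ Ω.q Ω.b t + (0, intVec v)) : Ω.coord x ∈ lattice Ω.d := by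
  obtain ⟨k, hk⟩ := Ω.sympDual_intVec v
  rw [mem_lattice Ω.d_pos]
  refine ⟨by simp [coord, h, geodesicLift], k, ?_⟩
  have hb : sympDual Ω.b (intVec Ω.b) = 0 := by
    rw [sympDual_apply, symp]
    ring
  have h2 : x.2 - Ω.q = t 1 • intVec Ω.b + intVec v := by
    rw [h]
    simp only [geodesicLift, Prod.snd_add]
    abel
  rw [coord, h2, map_add, map_smul, hb, hk, smul_zero, zero_add]

theorem eq_geodesicLift_iff {x : ℝ × (Fin 2 → ℝ)} (hx : x.1 = Ω.s₀) (t : Fin 2 → ℝ)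
    (v : Fin 2 → ℤ) : x = geodesicLift Ω.s₀ Ω.q Ω.b t + (0, intVec v) ↔
      x.2 - Ω.q = t 1 • intVec Ω.b + intVec v := by
  rw [Prod.ext_iff, sub_eq_iff_eq_add]
  simp only [geodesicLift, Prod.fst_add, add_zero, hx, true_and, Prod.snd_add]
  rw [add_comm Ω.q, add_right_comm]

theorem apply_eq_curve {σ : Simplex 2 (SolManifold f)}
    {K : (Fin 3 → ℝ) → ℝ × (Fin 2 → ℝ)} (hK : IsSmoothLift σ K) {n : ℤ} {v : Fin 2 → ℤ}
    (x : stdSimplex ℝ (Fin 3)) (t : stdSimplex ℝ (Fin 2))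
    (h : deck f n (K x.1) = geodesicLift Ω.s₀ Ω.q Ω.b t.1 + (0, intVec v)) : σ x = Ω.curve t := by
  rw [← hK.2 x, ← univCover_deck f n, h, univCover_add_intVec]
  exact (isSmoothLift_geodesicLift f Ω.s₀ Ω.q Ω.b).2 t

/-- A converse to `coord_mem_lattice_of_eq`. It needs `d` to be the greatest common divisor: for a
smaller divisor the lattice would contain values not attained on lifts of the geodesic. -/
theorem exists_curve_point (hb : Ω.b ≠ 0) (hd : Ω.d = (Int.gcd (Ω.b 0) (Ω.b 1) : ℝ)) {σ : Simplex 2 (SolManifold f)}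
    {K : (Fin 3 → ℝ) → ℝ × (Fin 2 → ℝ)} (hK : IsSmoothLift σ K) {n : ℤ}
    (x : stdSimplex ℝ (Fin 3)) (h : Ω.coord (deck f n (K x.1)) ∈ lattice Ω.d) :
    ∃ t, σ x = Ω.curve t := by
  obtain ⟨h1, k, h2⟩ := (mem_lattice Ω.d_pos _).1 h
  have h1' : (deck f n (K x.1)).1 = Ω.s₀ := sub_eq_zero.1 h1
  obtain ⟨t, ht, v, hv⟩ := exists_line_point hb (hd ▸ h2)
  refine ⟨⟨param t, param_mem ht⟩, Ω.apply_eq_curve hK (n := n) (v := v) _ _ ?_⟩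
  rw [Ω.eq_geodesicLift_iff h1', hv]
  rfl

end DualData

end SolLinking

end

/-! ### Crossings versus zeros of the charts -/

noncomputable section

namespace SolLinking

open MeasureTheory Set Filter Topology

variable {f : SL(2, ℤ)}

namespace DualData

variable (Ω : DualData f)

/-- The crossings of a `2`-simplex and the geodesic at which the determinant satisfies `P`. -/
def crossings (σ : Simplex 2 (SolManifold f)) (P : ℝ → Prop) :
    Set (stdSimplex ℝ (Fin 3) × stdSimplex ℝ (Fin 2)) :=
  {p | ∃ K L, IsSmoothLift σ K ∧ IsSmoothLift Ω.curve L ∧ K p.1.1 = L p.2.1 ∧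
    P (crossingDet K L p.1.1 p.2.1)}

/-- The zeros of a chart at which the Jacobian satisfies `P`. -/
def zeros (K : (Fin 3 → ℝ) → ℝ × (Fin 2 → ℝ)) (P : ℝ → Prop) (n : ℤ) : Set (ℝ × ℝ) :=
  {z ∈ Icc (0 : ℝ × ℝ) 1 | Ω.chart K n z ∈ lattice Ω.d ∧ P (fderiv ℝ (Ω.chart K n) z).det}

theorem crossings_fiber (hb : Ω.b ≠ 0) (hd : Ω.d = (Int.gcd (Ω.b 0) (Ω.b 1) : ℝ))
    {σ : Simplex 2 (SolManifold f)} {K : (Fin 3 → ℝ) → ℝ × (Fin 2 → ℝ)} (hK : IsSmoothLift σ K)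
    (hT : IsTransversal σ Ω.curve) {n : ℤ} (x : stdSimplex ℝ (Fin 3))
    (h : Ω.coord (deck f n (K x.1)) ∈ lattice Ω.d) :
    {p : stdSimplex ℝ (Fin 3) × stdSimplex ℝ (Fin 2) | p.1 = x ∧
      ∃ v, deck f n (K x.1) = geodesicLift Ω.s₀ Ω.q Ω.b p.2.1 + (0, intVec v)}.Finite ∧
    {p : stdSimplex ℝ (Fin 3) × stdSimplex ℝ (Fin 2) | p.1 = x ∧
      ∃ v, deck f n (K x.1) = geodesicLift Ω.s₀ Ω.q Ω.b p.2.1 + (0, intVec v)}.ncard =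
      Int.gcd (Ω.b 0) (Ω.b 1) := by
  obtain ⟨h1, k, h2⟩ := (mem_lattice Ω.d_pos _).1 h
  have h1' : (deck f n (K x.1)).1 = Ω.s₀ := sub_eq_zero.1 h1
  simp only [Ω.eq_geodesicLift_iff h1']
  set y := (deck f n (K x.1)).2 - Ω.q with hy
  -- An integral `y` would put the crossing at the parameter `t = 0`, which transversality at
  -- interior points forbids.
  have hy0 : ¬∃ v, y = intVec v := by
    rintro ⟨v, hv⟩
    have := (hT x ⟨param 0, param_mem ⟨le_rfl, zero_le_one⟩⟩ (Ω.apply_eq_curve hK (n := n) (v := v)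
      _ _ ((Ω.eq_geodesicLift_iff h1' _ _).2 (by simpa [param] using hv)))).2.1 1
    simp [param] at this
  obtain ⟨hfin, hcard⟩ := ncard_line_points hb (hd ▸ h2) hy0
  set S := {p : stdSimplex ℝ (Fin 3) × stdSimplex ℝ (Fin 2) | p.1 = x ∧
    ∃ v, y = p.2.1 1 • intVec Ω.b + intVec v} with hS
  have hinj : InjOn (fun p : stdSimplex ℝ (Fin 3) × stdSimplex ℝ (Fin 2) => p.2.1 1) S := by
    rintro ⟨x1, t1⟩ ⟨hx1, -⟩ ⟨x2, t2⟩ ⟨hx2, -⟩ (ht : t1.1 1 = t2.1 1)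
    have e1 : t1.1 0 + t1.1 1 = 1 := by rw [← Fin.sum_univ_two]; exact t1.2.2
    have e2 : t2.1 0 + t2.1 1 = 1 := by rw [← Fin.sum_univ_two]; exact t2.2.2
    refine Prod.ext (hx1.trans hx2.symm) (Subtype.ext (funext fun i => ?_))
    fin_cases i
    · change t1.1 0 = t2.1 0
      linarith
    · exact ht
  have himg : (fun p : stdSimplex ℝ (Fin 3) × stdSimplex ℝ (Fin 2) => p.2.1 1) '' S =
      {t ∈ Icc (0 : ℝ) 1 | ∃ v, y = t • intVec Ω.b + intVec v} := by
    ext t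
    constructor
    · rintro ⟨p, ⟨-, hp⟩, rfl⟩
      exact ⟨mem_Icc_of_mem_stdSimplex p.2.2 1, hp⟩
    · rintro ⟨ht, hv⟩
      exact ⟨(x, ⟨param t, param_mem ht⟩), ⟨rfl, hv⟩, rfl⟩
  exact ⟨Finite.of_finite_image (himg ▸ hfin) hinj,
    by rw [← hinj.ncard_image, himg, hcard]⟩

/-- The crossings are counted by the zeros of the charts of all translates. -/
theorem ncard_crossings (hb : Ω.b ≠ 0) (hd : Ω.d = (Int.gcd (Ω.b 0) (Ω.b 1) : ℝ))
    {σ : Simplex 2 (SolManifold f)} {K : (Fin 3 → ℝ) → ℝ × (Fin 2 → ℝ)} (hK : IsSmoothLift σ K)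
    (hT : IsTransversal σ Ω.curve) {P : ℝ → Prop} (hP0 : ¬P 0)
    (hP : ∀ u a : ℝ, 0 < u → (P (u * a) ↔ P a)) {F : Finset ℤ}
    (hF : ∀ n ∉ F, ∀ z ∈ Icc (0 : ℝ × ℝ) 1, Ω.chart K n z ∉ lattice Ω.d)
    (hfin : ∀ n ∈ F, (Ω.zeros K P n).Finite) :
    (Ω.crossings σ P).ncard = Int.gcd (Ω.b 0) (Ω.b 1) * ∑ n ∈ F, (Ω.zeros K P n).ncard := by
  set I : Set (ℤ × (ℝ × ℝ)) := ⋃ n ∈ (F : Set ℤ), Prod.mk n '' Ω.zeros K P n with hI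
  have hIfin : I.Finite := F.finite_toSet.biUnion fun n hn => (hfin n hn).image _
  have hIcard : I.ncard = ∑ n ∈ F, (Ω.zeros K P n).ncard := by
    rw [hI, ncard_biUnion F.finite_toSet (fun n hn => (hfin n hn).image _)]
    · rw [Finset.finite_toSet_toFinset]
      exact Finset.sum_congr rfl fun n _ => ncard_image_of_injective _ (Prod.mk_right_injective n)
    · intro n _ m _ hnm
      refine Set.disjoint_left.2 ?_
      rintro _ ⟨z, -, rfl⟩ ⟨w, -, hw⟩
      exact hnm (congrArg Prod.fst hw).symm
  have hmem : ∀ i : ℤ × (ℝ × ℝ), i ∈ I ↔ i.1 ∈ F ∧ i.2 ∈ Ω.zeros K P i.1 := by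
    rintro ⟨n, z⟩
    simp only [hI, mem_iUnion, mem_image, exists_prop, Finset.mem_coe]
    constructor
    · rintro ⟨m, hm, w, hw, h⟩
      obtain ⟨rfl, rfl⟩ := Prod.mk.inj h
      exact ⟨hm, hw⟩
    · rintro ⟨h1, h2⟩
      exact ⟨n, h1, z, h2, rfl⟩
  -- On the collapsed side the Jacobian vanishes, and `P` excludes the value `0`; so `duffy` is
  -- injective on the zeros counted.
  have hz1 : ∀ i ∈ I, 0 < i.2.1 := fun i hi => by
    have hz := ((hmem i).1 hi).2
    refine lt_of_le_of_ne hz.1.1.1 fun h => hP0 ?_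
    have := hz.2.2
    rwa [Ω.det_fderiv_chart hK.1, show i.2.1 = 0 from h.symm, zero_mul] at this
  set S : ℤ × (ℝ × ℝ) → Set (stdSimplex ℝ (Fin 3) × stdSimplex ℝ (Fin 2)) := fun i =>
    {p | p.1.1 = duffy i.2 ∧
      ∃ v, deck f i.1 (K (duffy i.2)) = geodesicLift Ω.s₀ Ω.q Ω.b p.2.1 + (0, intVec v)} with hS
  have hScard : ∀ i ∈ I, (S i).Finite ∧ (S i).ncard = Int.gcd (Ω.b 0) (Ω.b 1) := fun i hi => by
    have hz := ((hmem i).1 hi).2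
    have := Ω.crossings_fiber hb hd hK hT (n := i.1) ⟨duffy i.2, duffy_mem hz.1⟩ hz.2.1
    simp only [Subtype.ext_iff] at this
    exact this
  have hunion : Ω.crossings σ P = ⋃ i ∈ I, S i := by
    ext ⟨x, t⟩
    simp only [mem_iUnion, exists_prop]
    constructor
    · intro hp
      have hxt : σ x = Ω.curve t := by
        obtain ⟨K', L', hK', hL', h, -⟩ := hp
        rw [← hK'.2 x, ← hL'.2 t]
        exact congrArg _ h
      obtain ⟨hx, ht, -⟩ := hT x t hxt
      obtain ⟨n, v, hv, hPn⟩ := (exists_lifts_iff hK Ω.s₀ Ω.q Ω.b P x.2 hx t.2 ht).1 hp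
      obtain ⟨z, hz, hz0, hzx⟩ := exists_duffy_eq x.2 hx
      rw [← hzx] at hv hPn
      have hl : Ω.chart K n z ∈ lattice Ω.d := Ω.coord_mem_lattice_of_eq hv
      refine ⟨(n, z), (hmem _).2 ⟨?_, hz, hl, ?_⟩, hzx.symm, v, hv⟩
      · by_contra hn
        exact hF n hn z hz hl
      · rw [Ω.det_fderiv_chart hK.1]
        exact (hP _ _ hz0).2 hPn
    · rintro ⟨i, hi, hix, v, hv⟩
      have hz := ((hmem i).1 hi).2
      rw [← hix] at hv
      obtain ⟨hx, ht, -⟩ := hT x t (Ω.apply_eq_curve hK x t hv)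
      refine (exists_lifts_iff hK Ω.s₀ Ω.q Ω.b P x.2 hx t.2 ht).2 ⟨i.1, v, hv, ?_⟩
      have := hz.2.2
      rw [Ω.det_fderiv_chart hK.1, hP _ _ (hz1 i hi)] at this
      change x.1 = _ at hix
      rwa [hix]
  -- The point of the simplex determines `z`, and the level `s₀` determines the translate `n`.
  have hdisj : I.PairwiseDisjoint S := by
    intro i hi j hj hij
    refine Set.disjoint_left.2 ?_
    rintro ⟨x, t⟩ ⟨hx1, v1, h1⟩ ⟨hx2, v2, h2⟩
    have hz : i.2 = j.2 := duffy_injective (hz1 i hi).ne' (hx1.symm.trans hx2)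
    refine hij (Prod.ext ?_ hz)
    have e1 := congrArg Prod.fst h1
    have e2 := congrArg Prod.fst h2
    simp only [deck, geodesicLift, Prod.fst_add, add_zero, hz] at e1 e2
    have : (i.1 : ℝ) = j.1 := by linarith
    exact_mod_cast this
  rw [hunion, ncard_biUnion hIfin (fun i hi => (hScard i hi).1) hdisj,
    Finset.sum_congr rfl fun i hi => (hScard i (hIfin.mem_toFinset.1 hi)).2, Finset.sum_const,
    ← ncard_eq_toFinset_card _ hIfin, hIcard, smul_eq_mul, mul_comm]

/-- Each signed zero of a chart contributes `d` to the integral, and `d` crossings lie over it, so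
the integral is the crossing number itself. Equality holds for all small `r`, not only in the limit.
-/
theorem eventually_chainPairing_boundary (hb : Ω.b ≠ 0)
    (hd : Ω.d = (Int.gcd (Ω.b 0) (Ω.b 1) : ℝ)) {σ : Simplex 2 (SolManifold f)}
    (hσ : ∃ K, IsSmoothLift σ K) (hT : IsTransversal σ Ω.curve) :
    ∀ᶠ r in 𝓝[>] (0 : ℝ), Ω.chainPairing r (boundary 1 (Finsupp.single σ 1)) =
      ((crossingNumber σ Ω.curve : ℚ) : ℝ) := by
  obtain ⟨K, hK⟩ := hσ
  obtain ⟨F, hF, hpair⟩ := Ω.exists_finset_chainPairing hK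
  have hnd : ∀ n, ∀ z ∈ Icc (0 : ℝ × ℝ) 1, Ω.chart K n z ∈ lattice Ω.d →
      z ∈ interior (Icc (0 : ℝ × ℝ) 1) ∧ (fderiv ℝ (Ω.chart K n) z).det ≠ 0 := by
    intro n z hz hl
    obtain ⟨t, ht⟩ := Ω.exists_curve_point hb hd hK (n := n) ⟨duffy z, duffy_mem hz⟩ hl
    obtain ⟨hx, htp, hc⟩ := hT _ _ ht
    refine ⟨mem_interior_of_duffy_pos hz hx, ?_⟩
    have hc' : ∃ K' L', IsSmoothLift σ K' ∧ IsSmoothLift Ω.curve L' ∧ K' (duffy z) = L' t.1 ∧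
        crossingDet K' L' (duffy z) t.1 ≠ 0 := by
      rcases hc with ⟨K', L', hK', hL', h, hdet⟩ | ⟨K', L', hK', hL', h, hdet⟩
      · exact ⟨K', L', hK', hL', h, hdet.ne'⟩
      · exact ⟨K', L', hK', hL', h, hdet.ne⟩
    obtain ⟨m, v, hv, hdet⟩ := (exists_lifts_iff hK Ω.s₀ Ω.q Ω.b (· ≠ 0) (duffy_mem hz) hx t.2
      htp).1 hc'
    -- The crossing may come from other lifts a priori; its level `s₀` identifies the translate.
    have hmn : m = n := by
      have e1 := congrArg Prod.fst hv
      have e2 : (deck f n (K (duffy z))).1 - Ω.s₀ = 0 := hl.1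
      simp only [deck, geodesicLift, Prod.fst_add, add_zero] at e1 e2
      have : (m : ℝ) = n := by linarith
      exact_mod_cast this
    have hz0 : z.1 ≠ 0 := fun h0 => by
      have h1 : 0 < z.1 * z.2 := hx 2
      rw [h0, zero_mul] at h1
      exact lt_irrefl _ h1
    rw [Ω.det_fderiv_chart hK.1, ← hmn]
    exact mul_ne_zero hz0 hdet
  have hdeg := fun n => eventually_integral_density_eq Ω.d_pos
    ((Ω.contDiff_chart hK.1 n).of_le (by simp)) (hnd n)
  have hFl : ∀ n ∉ F, ∀ z ∈ Icc (0 : ℝ × ℝ) 1, Ω.chart K n z ∉ lattice Ω.d :=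
    fun n hn z hz hl => by
      have h1 := hF n hn z hz
      have h2 : (deck f n (K (duffy z))).1 - Ω.s₀ = 0 := hl.1
      rw [h2, abs_zero] at h1
      linarith
  have hfin : ∀ P n, (Ω.zeros K P n).Finite := fun P n =>
    (hdeg n).1.subset fun z hz => ⟨hz.1, hz.2.1⟩
  have hpos : {p | PosCrossing σ Ω.curve p}.ncard = _ :=
    Ω.ncard_crossings hb hd hK hT (P := fun a => 0 < a) (lt_irrefl _)
      (fun u a hu => mul_pos_iff_of_pos_left hu) hFl fun n _ => hfin _ n
  have hneg : {p | NegCrossing σ Ω.curve p}.ncard = _ :=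
    Ω.ncard_crossings hb hd hK hT (P := fun a => a < 0) (lt_irrefl _)
      (fun u a hu => ⟨fun h => by_contra fun h' => absurd h
        (not_lt.2 (mul_nonneg hu.le (not_lt.1 h'))), mul_neg_of_pos_of_neg hu⟩) hFl fun n _ => hfin _ n
  filter_upwards [(eventually_all_finset F).2 fun n _ => (hdeg n).2, Ioo_mem_nhdsGT one_pos]
    with r hr hr1
  refine (hpair r hr1.1 hr1.2).trans ((Finset.sum_congr rfl hr).trans ?_)
  rw [crossingNumber, hpos, hneg, ← Finset.mul_sum, Finset.sum_sub_distrib]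
  push_cast
  rw [← hd, mul_sub]
  rfl

end DualData

end SolLinking

end

/-! ### Evaluation on the geodesic and the linking number -/

noncomputable section

namespace SolLinking

open MeasureTheory Set Filter Topology

variable {f : SL(2, ℤ)}

/-! ### The linking number -/

/-- The translates lie at levels `s₀ - ε + n`. For `r < ε` and `r < 1 - ε` the plateau is `1` at `n
= 0` and `0` at all other `n`; the `ds` part does not see a path inside a fiber. -/
theorem DualData.eventually_chainPairing_geodesic (Ω : DualData f) {s ε : ℝ} (h0 : 0 < ε)
    (h1 : ε < 1) (hs : Ω.s₀ = s + ε) (p : Fin 2 → ℝ) (a : Fin 2 → ℤ) :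
    ∀ᶠ r in 𝓝[>] (0 : ℝ),
      Ω.chainPairing r (geodesicCycle f s (toTorus p) a) = Ω.c (intVec a) := by
  filter_upwards [Ioo_mem_nhdsGT h0, Ioo_mem_nhdsGT (sub_pos.2 h1)] with r hr hr'
  have hp : Ω.chainPairing r (geodesicCycle f s (toTorus p) a) =
      Ω.liftPairing r fun t => geodesicLift s p a (param t) := by
    rw [← Ω.simplexPairing_eq hr.1 (isSmoothLift_geodesicLift f s p a), chainPairing,
      geodesicCycle, Finsupp.linearCombination_single, one_smul]
  have hd : ∀ (n : ℤ) (t : ℝ), HasDerivAt (fun t => deck f n (geodesicLift s p a (param t)))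
      (0, linMap (f ^ n) (intVec a)) t := fun n t => by
    have h : (fun t => deck f n (geodesicLift s p a (param t))) = fun t : ℝ =>
        (s + n, linMap (f ^ n) p + t • linMap (f ^ n) (intVec a)) := by
      funext t
      simp [deck, geodesicLift, param]
    rw [h]
    refine (hasDerivAt_const t _).prodMk (HasDerivAt.const_add _ ?_)
    simpa only [one_smul, id_eq] using
      (hasDerivAt_id t).smul_const (linMap (f ^ n) (intVec a))
  have hi : ∀ n : ℤ, (Ω.pathIntegral r fun t => deck f n (geodesicLift s p a (param t))) =
      Ω.plateau r (s + n) * Ω.c (linMap (f ^ n) (intVec a)) := fun n => by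
    simp only [DualData.pathIntegral, (hd n _).deriv, Ω.form_apply, mul_zero, sub_zero]
    simp [deck, geodesicLift]
  rw [hp, DualData.liftPairing, finsum_congr hi, finsum_eq_single _ 0]
  · have e1 : step r (s + (0 : ℤ) - Ω.s₀ + 1) = 1 :=
      step_of_ge hr.1 (by rw [hs]; push_cast; linarith [hr'.2])
    have e2 : step r (s + (0 : ℤ) - Ω.s₀) = 0 :=
      step_of_le hr.1 (by rw [hs]; push_cast; linarith [hr.2])
    rw [DualData.plateau, e1, e2, zpow_zero, linMap_one, sub_zero, one_mul]
  · intro n hn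
    rcases lt_or_gt_of_ne hn with h | h
    · have hn' : (n : ℝ) ≤ -1 := by exact_mod_cast Int.le_sub_one_of_lt h
      rw [DualData.plateau, step_of_le hr.1 (by rw [hs]; linarith [hr.2]),
        step_of_le hr.1 (by rw [hs]; linarith [hr.2]), sub_zero, zero_mul]
    · have hn' : (1 : ℝ) ≤ n := by exact_mod_cast h
      rw [DualData.plateau, step_of_ge hr.1 (by rw [hs]; linarith [hr'.2]),
        step_of_ge hr.1 (by rw [hs]; linarith [hr'.2]), sub_self, zero_mul]

theorem intersectionNumber_single (A : Chain 2 (SolManifold f)) (τ : Simplex 1 (SolManifold f)) :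
    intersectionNumber A (Finsupp.single τ 1) = A.sum fun σ m => m * crossingNumber σ τ := by
  rw [intersectionNumber]
  refine Finsupp.sum_congr fun σ _ => ?_
  rw [Finsupp.sum_single_index (by simp), mul_one]

theorem GeneralPosition.isTransversal {A : Chain 2 (SolManifold f)} {τ : Simplex 1 (SolManifold f)}
    (h : GeneralPosition A (Finsupp.single τ 1)) {σ : Simplex 2 (SolManifold f)}
    (hσ : σ ∈ A.support) : IsTransversal σ τ :=
  h σ hσ τ (by simp)

/-- A single `r` is taken small enough for the geodesic and for the finitely many simplices of `A`;
both evaluations of the pairing on `∂A` then coincide. -/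
theorem intersectionNumber_eq_of_ne_zero (Ω : DualData f) (hb : Ω.b ≠ 0)
    (hd : Ω.d = (Int.gcd (Ω.b 0) (Ω.b 1) : ℝ)) {s ε : ℝ} (h0 : 0 < ε)
    (h1 : ε < 1) (hs : Ω.s₀ = s + ε) (p : Fin 2 → ℝ) (a : Fin 2 → ℤ)
    {A : Chain 2 (SolManifold f)} (hA : IsSmooth A)
    (hAb : boundary 1 A = geodesicCycle f s (toTorus p) a)
    (hgp : GeneralPosition A (Finsupp.single Ω.curve 1)) :
    ((intersectionNumber A (Finsupp.single Ω.curve 1) : ℚ) : ℝ) = Ω.c (intVec a) := by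
  have h2 := (eventually_all_finset A.support).2 fun σ hσ =>
    Ω.eventually_chainPairing_boundary hb hd (hA σ hσ) (hgp.isTransversal hσ)
  obtain ⟨r, hr, hr'⟩ := ((Ω.eventually_chainPairing_geodesic h0 h1 hs p a).and h2).exists
  rw [← hr, ← hAb, intersectionNumber_single]
  conv_rhs => rw [← Finsupp.sum_single A]
  rw [Finsupp.sum, Finsupp.sum, map_sum, map_sum, Rat.cast_sum]
  refine Finset.sum_congr rfl fun σ hσ => ?_
  rw [← mul_one (A σ), ← smul_eq_mul (A σ) 1, ← Finsupp.smul_single, map_smul, map_smul,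
    hr' σ hσ, smul_eq_mul, mul_one, Rat.smul_def]
  push_cast
  rfl

/-- A constant curve has zero tangent vector, so every crossing determinant vanishes. -/
theorem crossingNumber_geodesic_zero {σ : Simplex 2 (SolManifold f)} (hσ : ∃ K, IsSmoothLift σ K)
    (s₀ : ℝ) (q : Fin 2 → ℝ) (hT : IsTransversal σ (geodesic f s₀ (toTorus q) 0)) :
    crossingNumber σ (geodesic f s₀ (toTorus q) 0) = 0 := by
  obtain ⟨K, hK⟩ := hσ
  have h : ∀ P : ℝ → Prop, ¬P 0 → {p : stdSimplex ℝ (Fin 3) × stdSimplex ℝ (Fin 2) |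
      ∃ K L, IsSmoothLift σ K ∧ IsSmoothLift (geodesic f s₀ (toTorus q) 0) L ∧
        K p.1.1 = L p.2.1 ∧ P (crossingDet K L p.1.1 p.2.1)} = ∅ := by
    intro P hP
    refine eq_empty_of_forall_notMem ?_
    rintro ⟨x, t⟩ hp
    have hxt : σ x = geodesic f s₀ (toTorus q) 0 t := by
      obtain ⟨K', L', hK', hL', h, -⟩ := hp
      rw [← hK'.2 x, ← hL'.2 t]
      exact congrArg _ h
    obtain ⟨hx, ht, -⟩ := hT x t hxt
    obtain ⟨n, v, -, hPn⟩ := (exists_lifts_iff hK s₀ q 0 P x.2 hx t.2 ht).1 hp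
    refine hP ?_
    have h0 : translateDet f K 0 n x.1 = 0 := by
      simp [translateDet, frameDet_eq, symp, intVec]
    rwa [h0] at hPn
  have hpos : {p | PosCrossing σ (geodesic f s₀ (toTorus q) 0) p} = ∅ :=
    h (fun a => 0 < a) (lt_irrefl _)
  have hneg : {p | NegCrossing σ (geodesic f s₀ (toTorus q) 0) p} = ∅ :=
    h (fun a => a < 0) (lt_irrefl _)
  rw [crossingNumber, hpos, hneg, sub_self]

theorem det_invSubOne (f : SL(2, ℤ)) :
    (invSubOne f).det = ((2 - (f.1 0 0 + f.1 1 1) : ℤ) : ℚ) := by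
  have h : (f.1 0 0 : ℚ) * f.1 1 1 - f.1 0 1 * f.1 1 0 = 1 := by
    have := f.2
    rw [Matrix.det_fin_two] at this
    exact_mod_cast this
  rw [invSubOne, Matrix.SpecialLinearGroup.coe_inv, Matrix.adjugate_fin_two, Matrix.det_fin_two]
  simp
  linear_combination h

theorem isUnit_invSubOne (hf : (f : Matrix (Fin 2) (Fin 2) ℤ).IsHyperbolic) :
    IsUnit (invSubOne f) := by
  rw [Matrix.isUnit_iff_isUnit_det, det_invSubOne, isUnit_iff_ne_zero]
  exact_mod_cast sub_ne_zero.2 (Ne.symm (trace_ne_two hf))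

/-- The covector `w ↦ ⟨(f⁻¹ - 1)⁻¹ w, b⟩`. -/
theorem exists_covector (hf : (f : Matrix (Fin 2) (Fin 2) ℤ).IsHyperbolic) (b : Fin 2 → ℤ) :
    ∃ c : (Fin 2 → ℝ) →L[ℝ] ℝ, (∀ w, c (linMap f⁻¹ w) = c w + sympDual b w) ∧
      ∀ a : Fin 2 → ℤ, c (intVec a) = ((symplecticForm
        ((invSubOne f)⁻¹.mulVec (fun i => (a i : ℚ))) (fun i => (b i : ℚ)) : ℚ) : ℝ) := by
  set D : ℤ := 2 - (f.1 0 0 + f.1 1 1) with hD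
  have hD0 : (D : ℝ) ≠ 0 := by exact_mod_cast sub_ne_zero.2 (Ne.symm (trace_ne_two hf))
  have hDeq : (D : ℝ) = 2 - (f.1 0 0 + f.1 1 1) := by rw [hD]; push_cast; ring
  have hdet := det_eq_one f
  -- The coefficients come from Cramer's rule for `f⁻¹ - I`, whose determinant is `D`.
  refine ⟨(((f.1 0 0 - 1) * b 1 - f.1 1 0 * b 0) / D : ℝ) • ContinuousLinearMap.proj 0 +
    ((f.1 0 1 * b 1 - (f.1 1 1 - 1) * b 0) / D : ℝ) • ContinuousLinearMap.proj 1,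
    fun w => ?_, fun a => ?_⟩
  · have e0 : linMap f⁻¹ w 0 = f.1 1 1 * w 0 - f.1 0 1 * w 1 := by
      rw [linMap_apply, Matrix.SpecialLinearGroup.coe_inv, Matrix.adjugate_fin_two]
      simp [sub_eq_add_neg]
    have e1 : linMap f⁻¹ w 1 = -f.1 1 0 * w 0 + f.1 0 0 * w 1 := by
      rw [linMap_apply, Matrix.SpecialLinearGroup.coe_inv, Matrix.adjugate_fin_two]
      simp
    simp only [sympDual_apply, symp, intVec, add_apply, smul_apply, ContinuousLinearMap.proj_apply,
      smul_eq_mul, e0, e1]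
    field_simp
    rw [hDeq]
    linear_combination (w 0 * b 1 - w 1 * b 0) * hdet
  · have hinv : (invSubOne f)⁻¹ = (D : ℚ)⁻¹ • (invSubOne f).adjugate := by
      rw [Matrix.inv_def, det_invSubOne, Ring.inverse_eq_inv']
    rw [hinv, Matrix.adjugate_fin_two, invSubOne, Matrix.SpecialLinearGroup.coe_inv,
      Matrix.adjugate_fin_two]
    simp [symplecticForm, intVec, Matrix.mulVec, dotProduct, Fin.sum_univ_two]
    ring

theorem intersectionNumber_eq (hf : (f : Matrix (Fin 2) (Fin 2) ℤ).IsHyperbolic) {s ε : ℝ}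
    (h0 : 0 < ε) (h1 : ε < 1) (p q : Torus) (a b : Fin 2 → ℤ) {A : Chain 2 (SolManifold f)}
    (hA : IsSmooth A) (hAb : boundary 1 A = geodesicCycle f s p a)
    (hgp : GeneralPosition A (geodesicCycle f (s + ε) q b)) :
    intersectionNumber A (geodesicCycle f (s + ε) q b) = symplecticForm
      ((invSubOne f)⁻¹.mulVec (fun i => (a i : ℚ))) (fun i => (b i : ℚ)) := by
  obtain ⟨p, rfl⟩ := toTorus_surjective p
  obtain ⟨q, rfl⟩ := toTorus_surjective q
  by_cases hb : b = 0
  · subst hb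
    rw [geodesicCycle, intersectionNumber_single, Finsupp.sum, Finset.sum_eq_zero fun σ hσ => ?_]
    · simp [symplecticForm]
    · rw [crossingNumber_geodesic_zero (hA σ hσ) _ _ (hgp.isTransversal hσ), mul_zero]
  obtain ⟨c, hc, hca⟩ := exists_covector hf b
  have hd0 : 0 < Int.gcd (b 0) (b 1) := by
    refine Nat.pos_of_ne_zero fun h => hb (funext fun i => ?_)
    have := Int.gcd_eq_zero_iff.1 h
    fin_cases i
    exacts [this.1, this.2]
  have hdvd : ∀ i, ∃ k : ℤ, (b i : ℝ) = k * (Int.gcd (b 0) (b 1) : ℝ) := fun i => by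
    have h : ((Int.gcd (b 0) (b 1) : ℕ) : ℤ) ∣ b i := by
      fin_cases i
      exacts [Int.gcd_dvd_left _ _, Int.gcd_dvd_right _ _]
    obtain ⟨k, hk⟩ := h
    refine ⟨k, ?_⟩
    rw [mul_comm]
    exact_mod_cast hk
  have := intersectionNumber_eq_of_ne_zero (f := f)
    ⟨s + ε, q, b, (Int.gcd (b 0) (b 1) : ℝ), c, by exact_mod_cast hd0, hdvd, hc⟩ hb rfl h0 h1 rfl
    p a hA hAb hgp
  rw [hca] at this
  exact_mod_cast this

end SolLinking

end

theorem mainTheorem8 (f : Matrix.SpecialLinearGroup (Fin 2) ℤ)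
    (hf : (f : Matrix (Fin 2) (Fin 2) ℤ).IsHyperbolic)
    (s ε : ℝ) (hε₀ : 0 < ε) (hε₁ : ε < 1)
    (p q : SolLinking.Torus) (a b : Fin 2 → ℤ) :
    IsUnit (SolLinking.invSubOne f) ∧
    SolLinking.HasLinkingNumber
      (SolLinking.geodesicCycle f s p a)
      (SolLinking.geodesicCycle f (s + ε) q b)
      (SolLinking.symplecticForm
        ((SolLinking.invSubOne f)⁻¹.mulVec (fun i => (a i : ℚ))) (fun i => (b i : ℚ))) := by
  have hcap := SolLinking.exists_cap_of_mem
    (SolLinking.geodesicCycle_mem_capBoundaries hf s hε₀ hε₁ p q a b)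
  obtain ⟨A, hA, hAb, hgp⟩ := hcap
  -- Only a bounding chain is wanted here, so general position is asked with respect to an arbitrary
  -- auxiliary curve, a constant one.
  obtain ⟨B, hB, hBb, -⟩ := SolLinking.exists_cap_of_mem
    (SolLinking.geodesicCycle_mem_capBoundaries hf (s + ε) hε₀ hε₁ q q b 0)
  exact ⟨SolLinking.isUnit_invSubOne hf,
    { disjoint := SolLinking.disjoint_carrier_geodesicCycle f s hε₀ hε₁ p q a b
      bounds_left := ⟨A, hA, hAb⟩
      bounds_right := ⟨B, hB, hBb⟩
      exists_cap := ⟨A, hA, hAb, hgp⟩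
      intersection_eq := fun A hA hAb hgp =>
        SolLinking.intersectionNumber_eq hf hε₀ hε₁ p q a b hA hAb hgp }⟩
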